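/- **Conventions.** A represented space is a set $X$ with a surjective partial map $\delta_X:\subseteq\mathbb N^{\mathbb N}\to X$; $p$ is a name of $x$ if $\delta_X(p)=x$. For a partial multi-valued function $f:\subseteq X\rightrightarrows Y$ on represented spaces, with $\operatorname{dom}(f)=\{x: f(x)\neq\emptyset\}$, a partial function $F:\subseteq\mathbb N^{\mathbb N}\to\mathbb N^{\mathbb N}$ is a realizer of $f$ if for every name $p$ of a point $x\in\operatorname{dom}(f)$ the value $F(p)$ exists and is a name of some $y\in f(x)$. We write $f\le_W g$ (Weihrauch reducibility) if there are computable partial functions $K,H:\subseteq\mathbb N^{\mathbb N}\to\mathbb N^{\mathbb N}$ such that $p\mapsto H\langle p,GK(p)\rangle$ is a realizer of $f$ for every realizer $G$ of $g$. Products, finite powers and countable coproducts carry their canonical representations; $(f\times g)(x,z)=f(x)\times g(z)$, $(\bigsqcup_i f_i)(i,x)=\{i\}\times f_i(x)$, and $f^*=\bigsqcup_{n\in\mathbb N}f^n$ (finite parallelization), where $f^n$ is the $n$-fold product of $f$ with itself. The spaces $\{0,1\}$, $\mathbb R$, $[0,1]$ and $C([0,1],\mathbb R)$ (with the supremum metric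 and the rational polynomials as dense subset) carry their Cauchy representations, and a closed set $A\subseteq X$ is represented by negative information, i.e. by a list of rational open balls whose union is $X\setminus A$. **Problems.** * $\mathsf C_2$: given a non-empty (closed) set $A\subseteq\{0,1\}$, find a point of $A$. * $\mathsf{AUC}_{[0,1]}$ (all-or-unique choice): given a closed set $A\subseteq[0,1]$ that is either $[0,1]$ or a singleton, find a point of $A$. * $\mathsf{ConC}_{[0,1]}$ (connected choice): given a non-empty connected closed set $A\subseteq[0,1]$, find a point of $A$. * $\mathsf{IVT}$: given a continuous $f:[0,1]\to\mathbb R$ with $f(0)\cdot f(1)<0$, find $x\in[0,1]$ with $f(x)=0$. * $\mathsf{NASH}=\bigsqcup_{n,m\in\mathbb N}\mathsf{NASH}_{n,m}$, where $\mathsf{NASH}_{n,m}$ is: given $A,B\in\mathbb R^{n\times m}$, find a Nash equilibrium of the bi-matrix game $(A,B)$, i.e. a pair $(x,y)\in S^n\times S^m$ with $x^{\rm T}Ay\ge w^{\rm T}Ay$ for all $w\in S^n$ and $x^{\rm T}By\ge x^{\rm T}Bz$ for all $z\in S^m$, where $S^k=\{s\in\mathbb R^k: s_i\ge0,\ \sum_i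 s_i=1\}$. **Statement.** 1. $\mathsf C_2\times\mathsf{AUC}_{[0,1]}\not\le_W\mathsf{ConC}_{[0,1]}$; 2. $\mathsf{AUC}_{[0,1]}^*\not\le_W\mathsf{ConC}_{[0,1]}$; 3. $\mathsf{NASH}\not\le_W\mathsf{IVT}$. -/

import Mathlib

open TopologicalSpace

noncomputable section

namespace Weihrauch

/-! ### Computable functions on Baire space -/

/-- Baire space `ℕ^ℕ`. -/
abbrev Baire : Type := ℕ → ℕ

/-- The prefix `p(0) … p(n-1)` of length `n`. -/
def Baire.take (p : Baire) (n : ℕ) : List ℕ := (List.range n).map p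

/-- `⟨p, q⟩(2k) = p(k)` and `⟨p, q⟩(2k+1) = q(k)`. -/
def Baire.pair (p q : Baire) : Baire := fun n => if n % 2 = 0 then p (n / 2) else q (n / 2)

/-- First component of `⟨p, q⟩`. -/
def Baire.fst (r : Baire) : Baire := fun k => r (2 * k)

/-- Second component of `⟨p, q⟩`. -/
def Baire.snd (r : Baire) : Baire := fun k => r (2 * k + 1)

/-- `i`-th component of the countable tupling `⟨p₀, p₁, p₂, …⟩⟨i, j⟩ = pᵢ(j)`. -/
def Baire.comp (r : Baire) (i : ℕ) : Baire := fun j => r (Nat.pair i j)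

/-- `p(1) p(2) p(3) …`; the pairing `⟨k, p⟩ = k p` of a number with a sequence is inverted by
`r ↦ (r 0, r.tail)`. -/
def Baire.tail (r : Baire) : Baire := fun k => r (k + 1)

/-- A partial function `F :⊆ ℕ^ℕ → ℕ^ℕ` is computable if some computable monotone function `φ` on
finite words approximates it: for `p ∈ dom F` the words `φ(p(0) … p(m-1))` are prefixes of `F(p)`
of unbounded length. (Restrictions of computable functions count as computable.) -/
def ComputableFun (F : Baire →. Baire) : Prop :=
  ∃ φ : List ℕ → List ℕ, Computable φ ∧ (∀ u v, u <+: v → φ u <+: φ v) ∧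
    ∀ p q, q ∈ F p →
      (∀ m, φ (p.take m) = q.take (φ (p.take m)).length) ∧
      ∀ n, ∃ m, n ≤ (φ (p.take m)).length

/-! ### Represented spaces, realizers, Weihrauch reducibility -/

/-- A representation of `X`: a surjective partial map `δ :⊆ ℕ^ℕ → X`, given by its graph
`IsName p x :↔ δ(p) = x`. -/
class Represented (X : Type) where
  IsName : Baire → X → Prop
  unique : ∀ {p x y}, IsName p x → IsName p y → x = y
  surj : ∀ x, ∃ p, IsName p x

open Represented

/-- Partial multi-valued functions `f :⊆ X ⇉ Y`, with `dom f = {x | f x ≠ ∅}`. -/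
abbrev Multi (X Y : Type) : Type := X → Set Y

/-- `F ⊢ f`: for every name `p` of a point `x ∈ dom f`, the value `F(p)` exists and is a name of
some point of `f x`. -/
def Realizes {X Y : Type} [Represented X] [Represented Y] (F : Baire →. Baire) (f : Multi X Y) :
    Prop :=
  ∀ p x, IsName p x → (f x).Nonempty → ∃ q ∈ F p, ∃ y ∈ f x, IsName q y

/-- The partial function `H⟨id, GK⟩`. -/
def sandwich (H G K : Baire →. Baire) : Baire →. Baire :=
  fun p => (K p).bind fun q => (G q).bind fun r => H (p.pair r)

/-- Weihrauch reducibility `f ≤_W g`. -/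
def Reducible {X Y Z W : Type} [Represented X] [Represented Y] [Represented Z] [Represented W]
    (f : Multi X Y) (g : Multi Z W) : Prop :=
  ∃ K H : Baire →. Baire, ComputableFun K ∧ ComputableFun H ∧
    ∀ G : Baire →. Baire, Realizes G g → Realizes (sandwich H G K) f

/-! ### Products, coproducts, finite parallelization -/

theorem Baire.fst_pair (p q : Baire) : (p.pair q).fst = p := by
  funext k; simp [Baire.fst, Baire.pair]

theorem Baire.snd_pair (p q : Baire) : (p.pair q).snd = q := by
  funext k
  have h : (2 * k + 1) / 2 = k := by omega
  simp [Baire.snd, Baire.pair, Nat.add_mod, h]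

instance instProd {X Y : Type} [Represented X] [Represented Y] : Represented (X × Y) where
  IsName p u := IsName p.fst u.1 ∧ IsName p.snd u.2
  unique h h' := Prod.ext (unique h.1 h'.1) (unique h.2 h'.2)
  surj u := by
    obtain ⟨p, hp⟩ := surj u.1
    obtain ⟨q, hq⟩ := surj u.2
    exact ⟨p.pair q, by rwa [Baire.fst_pair], by rwa [Baire.snd_pair]⟩

/-- The representation of the `n`-fold product `X^n`. -/
instance instPow {X : Type} [Represented X] (n : ℕ) : Represented (Fin n → X) where
  IsName p u := ∀ i : Fin n, IsName (p.comp i) (u i)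
  unique h h' := funext fun i => unique (h i) (h' i)
  surj u := by
    choose q hq using fun i => surj (u i)
    refine ⟨fun k => if h : k.unpair.1 < n then q ⟨k.unpair.1, h⟩ k.unpair.2 else 0, fun i => ?_⟩
    convert hq i using 1
    funext j
    simp [Baire.comp]

/-- Matrices are represented as elements of `(X^m)^n`. -/
instance instMatrix {X : Type} [Represented X] (n m : ℕ) :
    Represented (Matrix (Fin n) (Fin m) X) :=
  inferInstanceAs (Represented (Fin n → Fin m → X))

/-- The representation of the countable coproduct: `⟨i, p⟩` is a name of `(i, x)` if `p` is a name
of `x`. -/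
instance instSigma {X : ℕ → Type} [∀ i, Represented (X i)] : Represented (Σ i, X i) where
  IsName p u := p 0 = u.1 ∧ IsName p.tail u.2
  unique := by
    rintro p ⟨i, x⟩ ⟨j, y⟩ ⟨h, hx⟩ ⟨h', hy⟩
    obtain rfl : i = j := h.symm.trans h'
    exact congrArg (Sigma.mk i) (unique hx hy)
  surj u := by
    obtain ⟨p, hp⟩ := surj u.2
    exact ⟨fun k => if k = 0 then u.1 else p (k - 1), rfl, hp⟩

/-- The product `f × g`. -/
def Multi.prod {X Y Z W : Type} (f : Multi X Y) (g : Multi Z W) : Multi (X × Z) (Y × W) :=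
  fun u => f u.1 ×ˢ g u.2

/-- The `n`-fold product `f^n`. -/
def Multi.pow {X Y : Type} (f : Multi X Y) (n : ℕ) : Multi (Fin n → X) (Fin n → Y) :=
  fun u => {v | ∀ i, v i ∈ f (u i)}

/-- The countable coproduct, `(⊔ᵢ fᵢ)(i, x) = {i} × fᵢ(x)`. -/
def Multi.coprod {X Y : ℕ → Type} (f : ∀ i, Multi (X i) (Y i)) : Multi (Σ i, X i) (Σ i, Y i) :=
  fun u => Sigma.mk u.1 '' f u.1 u.2

/-- The finite parallelization `f^* = ⊔ₙ f^n`. -/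
def Multi.star {X Y : Type} (f : Multi X Y) : Multi (Σ n : ℕ, Fin n → X) (Σ n : ℕ, Fin n → Y) :=
  Multi.coprod fun n => f.pow n

/-! ### Metric spaces with a dense sequence: Cauchy representation, closed sets -/

/-- A metric space with a distinguished dense sequence. -/
class DenseSeq (X : Type) [MetricSpace X] where
  seq : ℕ → X
  dense : DenseRange seq

open DenseSeq

/-- The Cauchy representation: `p` is a name of `x` if the points `seq (p i)` form a Cauchy
sequence with `d(seq (p i), seq (p j)) ≤ 2⁻ⁱ` for `i ≤ j` and limit `x`. -/
instance instCauchy {X : Type} [MetricSpace X] [DenseSeq X] : Represented X where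
  IsName p x := (∀ i j, i ≤ j → dist (seq (p i) : X) (seq (p j)) ≤ (1 / 2 : ℝ) ^ i) ∧
    Filter.Tendsto (fun i => (seq (p i) : X)) Filter.atTop (nhds x)
  unique h h' := tendsto_nhds_unique h.2 h'.2
  surj x := by
    have key : ∀ i : ℕ, ∃ k, dist (seq k : X) x < (1 / 2 : ℝ) ^ (i + 1) := fun i => by
      obtain ⟨k, hk⟩ := (dense (X := X)).exists_dist_lt x
        (show (0 : ℝ) < (1 / 2) ^ (i + 1) by positivity)
      exact ⟨k, by rwa [dist_comm]⟩
    choose p hp using key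
    refine ⟨p, fun i j hij => ?_, ?_⟩
    · have h1 := dist_triangle_right (seq (p i) : X) (seq (p j)) x
      have h2 : (1 / 2 : ℝ) ^ (j + 1) ≤ (1 / 2) ^ (i + 1) :=
        pow_le_pow_of_le_one (by norm_num) (by norm_num) (by omega)
      have h3 : (1 / 2 : ℝ) ^ i = 2 * (1 / 2) ^ (i + 1) := by rw [pow_succ]; ring
      linarith [hp i, hp j]
    · rw [tendsto_iff_dist_tendsto_zero]
      refine squeeze_zero (fun _ => dist_nonneg) (fun i => (hp i).le) ?_
      exact (tendsto_pow_atTop_nhds_zero_of_lt_one (by norm_num) (by norm_num)).comp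
        (Filter.tendsto_add_atTop_nat 1)

/-- A standard numbering of the rational numbers: `⟨a, ⟨b, c⟩⟩ ↦ (a - b) / (c + 1)`. -/
def ratOfNat (n : ℕ) : ℚ :=
  ((n.unpair.1 : ℚ) - (n.unpair.2.unpair.1 : ℚ)) / ((n.unpair.2.unpair.2 : ℚ) + 1)

theorem ratOfNat_surjective : Function.Surjective ratOfNat := by
  intro q
  refine ⟨Nat.pair q.num.toNat (Nat.pair (-q.num).toNat (q.den - 1)), ?_⟩
  have h1 : ((q.num.toNat : ℚ) - ((-q.num).toNat : ℚ)) = q.num := by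
    have : ((q.num.toNat : ℤ) - ((-q.num).toNat : ℤ)) = q.num := by omega
    exact_mod_cast congrArg (Int.cast : ℤ → ℚ) this
  have h2 : ((q.den - 1 : ℕ) : ℚ) + 1 = q.den := by
    have := q.pos
    have h : q.den - 1 + 1 = q.den := by omega
    exact_mod_cast h
  simp only [ratOfNat, Nat.unpair_pair, h1, h2]
  exact q.num_div_den

/-- A standard numbering of the open balls with centre in the dense sequence and rational radius
(empty if the radius is not positive). -/
def ratBall (X : Type) [MetricSpace X] [DenseSeq X] (n : ℕ) : Set X :=
  Metric.ball (seq n.unpair.1) (ratOfNat n.unpair.2 : ℝ)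

/-- The space `𝒜₋(X)` of closed subsets of `X` with respect to negative information: `p` is a name
of `A` if `X \ A = ⋃ᵢ B_{p(i)}`. -/
instance instCloseds {X : Type} [MetricSpace X] [DenseSeq X] : Represented (Closeds X) where
  IsName p A := (A : Set X)ᶜ = ⋃ i, ratBall X (p i)
  unique h h' := by
    apply SetLike.coe_injective
    rw [← compl_inj_iff, h, h']
  surj A := by
    classical
    obtain ⟨z, hz⟩ := ratOfNat_surjective 0
    have hempty : ratBall X (Nat.pair 0 z) = ∅ := by simp [ratBall, hz]
    refine ⟨fun k => if ratBall X k ⊆ (A : Set X)ᶜ then k else Nat.pair 0 z, ?_⟩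
    apply Set.Subset.antisymm
    · intro x hx
      obtain ⟨ε, hε, hb⟩ := Metric.isOpen_iff.1 A.isClosed.isOpen_compl x hx
      obtain ⟨r, hr0, hr⟩ := exists_rat_btwn (half_pos hε)
      obtain ⟨k, hk⟩ := (dense (X := X)).exists_dist_lt x hr0
      obtain ⟨j, hj⟩ := ratOfNat_surjective r
      have hball : ratBall X (Nat.pair k j) = Metric.ball (seq k) (r : ℝ) := by
        simp [ratBall, hj]
      have hsub : ratBall X (Nat.pair k j) ⊆ (A : Set X)ᶜ := by
        rw [hball]
        refine (Metric.ball_subset_ball' ?_).trans hb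
        rw [dist_comm]; linarith
      refine Set.mem_iUnion.2 ⟨Nat.pair k j, ?_⟩
      simp only [if_pos hsub]
      rw [hball]
      exact hk
    · refine Set.iUnion_subset fun k => ?_
      by_cases h : ratBall X k ⊆ (A : Set X)ᶜ
      · simp only [if_pos h]
        exact h
      · simp only [if_neg h]
        rw [hempty]; exact Set.empty_subset _

/-! ### The spaces `2 = {0, 1}`, `ℝ`, `[0,1]` and `C([0,1], ℝ)` -/

/-- The discrete space `2 = {0, 1}`. -/
abbrev Two : Type := {n : ℕ // n < 2}

instance instTwo : DenseSeq Two where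
  seq n := ⟨n % 2, Nat.mod_lt _ two_pos⟩
  dense := Function.Surjective.denseRange fun x => ⟨x.1, Subtype.ext (Nat.mod_eq_of_lt x.2)⟩

instance instReal : DenseSeq ℝ where
  seq n := (ratOfNat n : ℝ)
  dense := Rat.denseRange_cast.comp ratOfNat_surjective.denseRange Rat.continuous_coe_real

/-- `[0,1]` with the rational numbers (clamped to `[0,1]`) as dense sequence. -/
instance instUnit : DenseSeq unitInterval where
  seq n := Set.projIcc (0 : ℝ) 1 zero_le_one (ratOfNat n : ℝ)
  dense := (Set.projIcc_surjective (zero_le_one (α := ℝ))).denseRange.comp instReal.dense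
    continuous_projIcc

/-- The polynomial `q_{k₀} + q_{k₁} X + q_{k₂} X² + …` with rational coefficients, where `n` encodes
the list `[k₀, k₁, k₂, …]` and `q_k` is the `k`-th rational number. -/
def ratPoly (n : ℕ) : Polynomial ℝ :=
  (Denumerable.ofNat (List ℕ) n).foldr
    (fun k P => Polynomial.C (ratOfNat k : ℝ) + Polynomial.X * P) 0

theorem ratPoly_denseRange :
    DenseRange fun n => (ratPoly n).toContinuousMapOn unitInterval := by
  set S : Set C(unitInterval, ℝ) :=
    Set.range fun n => (ratPoly n).toContinuousMapOn unitInterval with hS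
  have hstep : ∀ (c : ℝ) (f : C(unitInterval, ℝ)), f ∈ closure S →
      ContinuousMap.const _ c + Polynomial.X.toContinuousMapOn unitInterval * f ∈ closure S := by
    intro c f hf
    refine map_mem_closure₂ (f := fun (c : ℝ) (f : C(unitInterval, ℝ)) =>
      ContinuousMap.const _ c + Polynomial.X.toContinuousMapOn unitInterval * f)
      ?_ (instReal.dense c) hf ?_
    · exact (ContinuousMap.continuous_const'.comp continuous_fst).add
        (continuous_const.mul continuous_snd)
    · rintro _ ⟨k, rfl⟩ _ ⟨n, rfl⟩
      refine ⟨Encodable.encode (k :: Denumerable.ofNat (List ℕ) n), ?_⟩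
      ext x
      simp [ratPoly, seq]
  have hzero : (0 : C(unitInterval, ℝ)) ∈ closure S := by
    refine subset_closure ⟨Encodable.encode ([] : List ℕ), ?_⟩
    ext x
    simp [ratPoly]
  have hpoly : ∀ (N : ℕ) (P : Polynomial ℝ), P.natDegree ≤ N →
      P.toContinuousMapOn unitInterval ∈ closure S := by
    intro N
    induction N with
    | zero =>
      intro P hP
      convert hstep (P.coeff 0) 0 hzero using 1
      rw [Polynomial.eq_C_of_natDegree_le_zero hP]
      ext x
      simp
    | succ N ih =>
      intro P hP
      have hd : P.divX.natDegree ≤ N := by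
        rw [Polynomial.natDegree_divX_eq_natDegree_tsub_one]; omega
      convert hstep (P.coeff 0) _ (ih _ hd) using 1
      ext x
      conv_lhs => rw [← P.divX_mul_X_add]
      simp
      ring
  intro f
  have hf : f ∈ closure (polynomialFunctions unitInterval : Set C(unitInterval, ℝ)) :=
    continuousMap_mem_polynomialFunctions_closure 0 1 f
  refine closure_minimal ?_ isClosed_closure hf
  rw [polynomialFunctions_coe]
  rintro _ ⟨P, rfl⟩
  exact hpoly _ P le_rfl

instance instContinuousMap : DenseSeq C(unitInterval, ℝ) where
  seq n := (ratPoly n).toContinuousMapOn unitInterval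
  dense := ratPoly_denseRange

/-! ### The problems -/

/-- Closed choice `C_X`: given a non-empty closed set, find a point of it. -/
def closedChoice (X : Type) [MetricSpace X] : Multi (Closeds X) X := fun A => (A : Set X)

/-- All-or-unique choice `AUC_X`: closed choice restricted to `X` and the singletons. -/
def allOrUniqueChoice (X : Type) [MetricSpace X] : Multi (Closeds X) X :=
  fun A => {x | x ∈ A ∧ ((A : Set X) = Set.univ ∨ ∃ y, (A : Set X) = {y})}

/-- Connected choice `ConC_X`: closed choice restricted to connected sets. -/
def connectedChoice (X : Type) [MetricSpace X] : Multi (Closeds X) X :=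
  fun A => {x | x ∈ A ∧ IsConnected (A : Set X)}

/-- `IVT`: given a continuous `f : [0,1] → ℝ` with `f(0) · f(1) < 0`, find a zero of `f`. -/
def IVT : Multi C(unitInterval, ℝ) unitInterval :=
  fun f => {x | f 0 * f 1 < 0 ∧ f x = 0}

open Matrix in
/-- `(x, y)` is a Nash equilibrium of the bi-matrix game `(A, B)`. -/
def IsNash {n m : ℕ} (A B : Matrix (Fin n) (Fin m) ℝ) (x : Fin n → ℝ) (y : Fin m → ℝ) : Prop :=
  x ∈ stdSimplex ℝ (Fin n) ∧ y ∈ stdSimplex ℝ (Fin m) ∧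
    (∀ w ∈ stdSimplex ℝ (Fin n), w ⬝ᵥ A *ᵥ y ≤ x ⬝ᵥ A *ᵥ y) ∧
    (∀ z ∈ stdSimplex ℝ (Fin m), x ⬝ᵥ B *ᵥ z ≤ x ⬝ᵥ B *ᵥ y)

/-- `NASH_{n,m}`: given an `n × m` bi-matrix game, find a Nash equilibrium. -/
def NASHOf (n m : ℕ) : Multi (Matrix (Fin n) (Fin m) ℝ × Matrix (Fin n) (Fin m) ℝ)
    ((Fin n → ℝ) × (Fin m → ℝ)) :=
  fun G => {s | IsNash G.1 G.2 s.1 s.2}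

/-- `NASH = ⊔_{n,m} NASH_{n,m}`. -/
def NASH : Multi
    (Σ n : ℕ, Σ m : ℕ, Matrix (Fin n) (Fin m) ℝ × Matrix (Fin n) (Fin m) ℝ)
    (Σ n : ℕ, Σ m : ℕ, (Fin n → ℝ) × (Fin m → ℝ)) :=
  Multi.coprod fun n => Multi.coprod fun m => NASHOf n m

end Weihrauch

end

namespace Weihrauch

open TopologicalSpace Represented DenseSeq Set

/-! ### Prefixes and continuity of computable functions -/

/-! All three statements are instances of `IsSplitting.not_reducible`. Only continuity of the
reduction matters: `K` and `H` have moduli (`ComputableFun.exists_modulus`), so even continuous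
reductions are excluded.

Let the splitting instance be sent to an instance with compact solution set `S` in [0,1]. Near each
point of `S`, the answer computed by `H` has a reading `β` that is either below 1 or above 0, and
this persists for nearby instances. By compactness `S` is covered by open sets `W₀`, forcing `β <
1`, and `W₁`, forcing `0 < β`, where `W₀` has finite frontier because it is built from balls of an
interval. At each frontier point `H` fixes `t` up to a small error. Finitely many such values miss
some `y` in [0,1], so a perturbed instance forcing `t = y` has no transformed solution on the
frontier. Tameness then keeps a solution in `W₀`, or one outside it and hence in `W₁`, under all
smaller perturbations; forcing `β = 1` or `β = 0`, respectively, is a contradiction.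

Connected choice is tame because a connected set missing a frontier lies on one side of it
(`isTame_connectedChoice`). `IVT` is tame because a sign change between two points not separated by
the frontier is robust (`isTame_IVT`). The choice problems split by shrinking one factor after the
other to a point; `NASH` splits through a game in which one parameter fixes a marginal of the row
strategy and an independent bonus fixes another. -/

/-- `p` and `q` have the same prefix of length `n`. -/
def AgreeOn (n : ℕ) (p q : Baire) : Prop := ∀ i < n, p i = q i

theorem AgreeOn.refl (n : ℕ) (p : Baire) : AgreeOn n p p := fun _ _ => rfl

theorem AgreeOn.trans {n : ℕ} {p q r : Baire} (h : AgreeOn n p q) (h' : AgreeOn n q r) :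
    AgreeOn n p r := fun i hi => (h i hi).trans (h' i hi)

theorem AgreeOn.mono {m n : ℕ} {p q : Baire} (h : AgreeOn n p q) (hmn : m ≤ n) :
    AgreeOn m p q := fun i hi => h i (hi.trans_le hmn)

theorem AgreeOn.pair {n : ℕ} {p p' q q' : Baire} (h : AgreeOn n p p') (h' : AgreeOn n q q') :
    AgreeOn n (p.pair q) (p'.pair q') := by
  intro i hi
  have : i / 2 < n := by omega
  simp only [Baire.pair, h _ this, h' _ this]

theorem AgreeOn.fst {n : ℕ} {p q : Baire} (h : AgreeOn (2 * n) p q) : AgreeOn n p.fst q.fst :=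
  fun i hi => h (2 * i) (by omega)

theorem AgreeOn.snd {n : ℕ} {p q : Baire} (h : AgreeOn (2 * n) p q) : AgreeOn n p.snd q.snd :=
  fun i hi => h (2 * i + 1) (by omega)

theorem AgreeOn.tail {n : ℕ} {p q : Baire} (h : AgreeOn (n + 1) p q) : AgreeOn n p.tail q.tail :=
  fun i hi => h (i + 1) (by omega)

theorem AgreeOn.comp {n : ℕ} {p q : Baire} (i : ℕ) (h : AgreeOn (Nat.pair i n) p q) :
    AgreeOn n (p.comp i) (q.comp i) :=
  fun _ hj => h _ (Nat.pair_lt_pair_right i hj)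

/-- The sequence `k p`. -/
def Baire.cons (k : ℕ) (p : Baire) : Baire := fun i => if i = 0 then k else p (i - 1)

theorem Baire.tail_cons (k : ℕ) (p : Baire) : (Baire.cons k p).tail = p := by
  funext i; simp [Baire.tail, Baire.cons]

theorem AgreeOn.cons {n : ℕ} {p q : Baire} (k : ℕ) (h : AgreeOn n p q) :
    AgreeOn n (Baire.cons k p) (Baire.cons k q) := by
  intro i hi
  simp only [Baire.cons]
  split_ifs
  · rfl
  · exact h _ (by omega)

/-- The countable tupling, inverted by `Baire.comp`. -/
def Baire.tuple (q : ℕ → Baire) : Baire := fun k => q k.unpair.1 k.unpair.2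

theorem Baire.comp_tuple (q : ℕ → Baire) (i : ℕ) : (Baire.tuple q).comp i = q i := by
  funext j; simp [Baire.comp, Baire.tuple]

theorem AgreeOn.tuple {n : ℕ} {p q : ℕ → Baire} (h : ∀ i, AgreeOn n (p i) (q i)) :
    AgreeOn n (Baire.tuple p) (Baire.tuple q) :=
  fun k hk => h _ _ ((Nat.unpair_right_le k).trans_lt hk)

/-- A prefix of the output is already produced by the approximating word function on a prefix of the
input. Nothing else about computability is used. -/
theorem ComputableFun.exists_modulus {F : Baire →. Baire} (hF : ComputableFun F) {p q : Baire}
    (hq : q ∈ F p) (n : ℕ) :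
    ∃ m, ∀ p' q', AgreeOn m p p' → q' ∈ F p' → AgreeOn n q q' := by
  obtain ⟨φ, -, -, h⟩ := hF
  obtain ⟨m, hm⟩ := (h p q hq).2 n
  refine ⟨m, fun p' q' hp hq' i hi => ?_⟩
  have htake : p.take m = p'.take m :=
    List.map_congr_left fun j hj => hp j (List.mem_range.1 hj)
  have h1 := (h p q hq).1 m
  have h2 := (h p' q' hq').1 m
  rw [← htake, h1] at h2
  generalize (φ (p.take m)).length = L at h2 hm
  simp only [Baire.take, List.length_map, List.length_range] at h2
  have := congrArg (fun l => l[i]?) h2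
  simpa [List.getElem?_range (hi.trans_le hm)] using this

/-- What a Weihrauch reduction does on names, with the realizer of `g` eliminated. -/
theorem Reducible.exists_continuous {X Y Z W : Type} [Represented X] [Represented Y]
    [Represented Z] [Represented W] {f : Multi X Y} {g : Multi Z W} (h : Reducible f g) :
    ∃ K H : Baire →. Baire, ComputableFun K ∧ ComputableFun H ∧
      ∀ p x, IsName p x → (f x).Nonempty →
        ∃ q ∈ K p, ∃ z, IsName q z ∧ (g z).Nonempty ∧
          ∀ r, ∀ w ∈ g z, IsName r w → ∃ s ∈ H (p.pair r), ∃ y ∈ f x, IsName s y := by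
  classical
  obtain ⟨K, H, hK, hH, hKH⟩ := h
  refine ⟨K, H, hK, hH, fun p x hp hx => ?_⟩
  have hex : ∀ q, (∃ z, IsName q z ∧ (g z).Nonempty) →
      ∃ r : Baire, ∀ z, IsName q z → ∃ w ∈ g z, IsName r w := by
    rintro q ⟨z, hz, w, hw⟩
    obtain ⟨r, hr⟩ := surj w
    exact ⟨r, fun z' hz' => ⟨w, unique hz hz' ▸ hw, hr⟩⟩
  let G : Baire →. Baire := fun q =>
    ⟨∃ z, IsName q z ∧ (g z).Nonempty, fun hq => (hex q hq).choose⟩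
  have hG : Realizes G g := fun q z hz hne =>
    ⟨_, Part.get_mem (o := G q) ⟨z, hz, hne⟩, (hex q ⟨z, hz, hne⟩).choose_spec z hz⟩
  -- `G` is undefined except on names of instances in the domain of `g`, so definedness of the
  -- composite makes `K p` such a name.
  obtain ⟨s, hs, -⟩ := hKH G hG p x hp hx
  obtain ⟨q, hq, hs⟩ := Part.mem_bind_iff.1 hs
  obtain ⟨r, ⟨⟨z, hz, hne⟩, -⟩, -⟩ := Part.mem_bind_iff.1 hs
  refine ⟨q, hq, z, hz, hne, fun r w hw hr => ?_⟩
  -- A realizer may be altered at the single name `q`, so every name of every solution has to be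
  -- handled by `H`.
  let G' : Baire →. Baire := fun q' => if q' = q then Part.some r else G q'
  have hG' : Realizes G' g := by
    intro q' z' hz' hne'
    by_cases hqq : q' = q
    · subst hqq
      exact ⟨r, by simp [G'], w, unique hz hz' ▸ hw, hr⟩
    · obtain ⟨r', hr', h⟩ := hG q' z' hz' hne'
      exact ⟨r', by simpa [G', hqq] using hr', h⟩
  obtain ⟨s, hs, y, hy, hsy⟩ := hKH G' hG' p x hp hx
  obtain ⟨q', hq', hs⟩ := Part.mem_bind_iff.1 hs
  obtain rfl := Part.mem_unique hq hq'
  obtain ⟨r', hr', hs⟩ := Part.mem_bind_iff.1 hs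
  have : r' = r := by simpa [G'] using hr'
  exact ⟨s, this ▸ hs, y, hy, hsy⟩

/-! ### Names of points in metric spaces -/

/-- `p` approximates `x` so well that every prefix of `p` extends to names of all points near `x`. -/
def IsOpenName {X : Type} [MetricSpace X] [DenseSeq X] (p : Baire) (x : X) : Prop :=
  ∀ i, dist (seq (p i) : X) x < (1 / 2 : ℝ) ^ (i + 1)

section Metric

variable {X : Type} [MetricSpace X] [DenseSeq X]

/-- Two errors below `2^-(i+1)` stay within the tolerance `2^-i`; strictness of the bound is what
leaves room to move the point. -/
theorem IsOpenName.isName {p : Baire} {x : X} (hp : IsOpenName p x) : IsName p x := by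
  refine ⟨fun i j hij => ?_, ?_⟩
  · have h1 := dist_triangle_right (seq (p i) : X) (seq (p j)) x
    have h2 : (1 / 2 : ℝ) ^ (j + 1) ≤ (1 / 2) ^ (i + 1) :=
      pow_le_pow_of_le_one (by norm_num) (by norm_num) (by omega)
    have h3 : (1 / 2 : ℝ) ^ i = 2 * (1 / 2) ^ (i + 1) := by rw [pow_succ]; ring
    linarith [hp i, hp j]
  · rw [tendsto_iff_dist_tendsto_zero]
    refine squeeze_zero (fun _ => dist_nonneg) (fun i => (hp i).le) ?_
    exact (tendsto_pow_atTop_nhds_zero_of_lt_one (by norm_num) (by norm_num)).comp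
      (Filter.tendsto_add_atTop_nat 1)

theorem exists_isOpenName (x : X) : ∃ p, IsOpenName p x := by
  have key : ∀ i : ℕ, ∃ k, dist (seq k : X) x < (1 / 2 : ℝ) ^ (i + 1) := fun i => by
    obtain ⟨k, hk⟩ := (dense (X := X)).exists_dist_lt x
      (show (0 : ℝ) < (1 / 2) ^ (i + 1) by positivity)
    exact ⟨k, by rwa [dist_comm]⟩
  choose p hp using key
  exact ⟨p, hp⟩

/-- The points with an open name that agrees with `p` up to `n`. -/
def nameNhd (X : Type) [MetricSpace X] [DenseSeq X] (p : Baire) (n : ℕ) : Set X :=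
  ⋂ i ∈ Finset.range n, Metric.ball (seq (p i)) ((1 / 2 : ℝ) ^ (i + 1))

theorem isOpen_nameNhd (p : Baire) (n : ℕ) : IsOpen (nameNhd X p n) :=
  isOpen_biInter_finset fun _ _ => Metric.isOpen_ball

theorem IsOpenName.mem_nameNhd {p : Baire} {x : X} (hp : IsOpenName p x) (n : ℕ) :
    x ∈ nameNhd X p n := by
  simp only [nameNhd, mem_iInter, Metric.mem_ball]
  exact fun i _ => by rw [dist_comm]; exact hp i

theorem exists_isOpenName_of_mem_nameNhd {p : Baire} {n : ℕ} {x : X} (hx : x ∈ nameNhd X p n) :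
    ∃ p', IsOpenName p' x ∧ AgreeOn n p p' := by
  obtain ⟨q, hq⟩ := exists_isOpenName x
  refine ⟨fun i => if i < n then p i else q i, fun i => ?_, fun i hi => by simp [hi]⟩
  simp only [nameNhd, mem_iInter, Metric.mem_ball, Finset.mem_range] at hx
  by_cases hi : i < n
  · simpa [hi, dist_comm] using hx i hi
  · simpa [hi] using hq i

theorem dist_seq_le_of_isName {p : Baire} {x : X} (hp : IsName p x) (n : ℕ) :
    dist (seq (p n) : X) x ≤ (1 / 2 : ℝ) ^ n :=
  le_of_tendsto (tendsto_const_nhds.dist hp.2)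
    (Filter.eventually_atTop.2 ⟨n, fun j hj => hp.1 n j hj⟩)

theorem exists_dist_lt_of_isName {p : Baire} {x : X} (hp : IsName p x) {ε : ℝ} (hε : 0 < ε) :
    ∃ n, ∀ p' x', AgreeOn n p p' → IsName p' x' → dist x' x < ε := by
  obtain ⟨n, hn⟩ := exists_pow_lt_of_lt_one (half_pos hε) (show (1 / 2 : ℝ) < 1 by norm_num)
  refine ⟨n + 1, fun p' (x' : X) hpp hp' => ?_⟩
  have h1 := dist_seq_le_of_isName hp n
  have h2 := dist_seq_le_of_isName hp' n
  rw [← hpp n (by omega)] at h2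
  linarith [dist_triangle_left x' x (seq (p n))]

end Metric

/-! ### Real-valued functions that are continuous with respect to names -/

/-- `h : X → ℝ` is continuous with respect to the representation of `X`. -/
def NameContinuous {X : Type} [Represented X] (h : X → ℝ) : Prop :=
  ∀ p x, IsName p x → ∀ ε > 0, ∃ n, ∀ p' x', AgreeOn n p p' → IsName p' x' → |h x' - h x| < ε

section NameContinuous

variable {X Y : Type}

theorem nameContinuous_const [Represented X] (c : ℝ) : NameContinuous fun _ : X => c :=
  fun _ _ _ ε hε => ⟨0, fun _ _ _ _ => by simpa using hε⟩

theorem NameContinuous.add [Represented X] {h k : X → ℝ} (hh : NameContinuous h)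
    (hk : NameContinuous k) : NameContinuous fun x => h x + k x := by
  intro p x hp ε hε
  obtain ⟨n, hn⟩ := hh p x hp _ (half_pos hε)
  obtain ⟨m, hm⟩ := hk p x hp _ (half_pos hε)
  refine ⟨max n m, fun p' x' hpp hp' => ?_⟩
  have h1 := hn p' x' (hpp.mono (le_max_left _ _)) hp'
  have h2 := hm p' x' (hpp.mono (le_max_right _ _)) hp'
  rw [abs_lt] at *
  constructor <;> linarith [h1.1, h1.2, h2.1, h2.2]

theorem nameContinuous_of_continuous [MetricSpace X] [DenseSeq X] {h : X → ℝ} (hh : Continuous h) :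
    NameContinuous h := by
  intro p x hp ε hε
  obtain ⟨δ, hδ, hd⟩ := Metric.continuous_iff.1 hh x ε hε
  obtain ⟨n, hn⟩ := exists_dist_lt_of_isName hp hδ
  exact ⟨n, fun p' x' hpp hp' => hd x' (hn p' x' hpp hp')⟩

theorem NameContinuous.comp_fst [Represented X] [Represented Y] {h : X → ℝ}
    (hh : NameContinuous h) : NameContinuous fun u : X × Y => h u.1 := by
  intro p x hp ε hε
  obtain ⟨n, hn⟩ := hh _ _ hp.1 ε hε
  exact ⟨2 * n, fun p' x' hpp hp' => hn _ _ hpp.fst hp'.1⟩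

theorem NameContinuous.comp_snd [Represented X] [Represented Y] {h : Y → ℝ}
    (hh : NameContinuous h) : NameContinuous fun u : X × Y => h u.2 := by
  intro p x hp ε hε
  obtain ⟨n, hn⟩ := hh _ _ hp.2 ε hε
  exact ⟨2 * n, fun p' x' hpp hp' => hn _ _ hpp.snd hp'.2⟩

/-- The value of `h` at the `i`-th coordinate, or `0` if there is no such coordinate. -/
noncomputable def coordValue (h : X → ℝ) (i : ℕ) {n : ℕ} (v : Fin n → X) : ℝ :=
  if hi : i < n then h (v ⟨i, hi⟩) else 0

theorem NameContinuous.coordValue [Represented X] {h : X → ℝ} (hh : NameContinuous h) (i n : ℕ) :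
    NameContinuous fun v : Fin n → X => coordValue h i v := by
  unfold Weihrauch.coordValue
  split_ifs with hi
  · intro p v hp ε hε
    obtain ⟨k, hk⟩ := hh _ _ (hp ⟨i, hi⟩) ε hε
    exact ⟨Nat.pair i k, fun p' v' hpp hp' => hk _ _ (hpp.comp i) (hp' ⟨i, hi⟩)⟩
  · exact nameContinuous_const 0

/-- The first entry of a name is the index, so agreement there already fixes the summand. -/
theorem NameContinuous.sigma {X : ℕ → Type} [∀ i, Represented (X i)] {h : (Σ i, X i) → ℝ}
    (hh : ∀ i, NameContinuous fun x => h ⟨i, x⟩) : NameContinuous h := by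
  rintro p ⟨i, x⟩ ⟨hi, hp⟩ ε hε
  obtain ⟨n, hn⟩ := hh i _ x hp ε hε
  refine ⟨n + 1, ?_⟩
  rintro p' ⟨j, x'⟩ hpp ⟨hj, hp'⟩
  obtain rfl : i = j := by
    have := hpp 0 (by omega)
    simp only at hi hj
    omega
  exact hn _ _ hpp.tail hp'

end NameContinuous

/-! ### The separation argument -/

/-- A problem with solutions in `[0,1]` whose solution sets are closed and depend upper
semicontinuously on the name, and in which a solution cannot be moved across a finite frontier
without meeting it. -/
structure IsTame {Z : Type} [Represented Z] (g : Multi Z unitInterval) : Prop where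
  isClosed : ∀ z, IsClosed (g z)
  subset_stable : ∀ q z, IsName q z → (g z).Nonempty → ∀ W, IsOpen W → g z ⊆ W →
    ∃ n, ∀ q' z', AgreeOn n q q' → IsName q' z' → (g z').Nonempty → g z' ⊆ W
  inter_stable : ∀ q z, IsName q z → (g z).Nonempty → ∀ W, IsOpen W → (frontier W).Finite →
    Disjoint (g z) (frontier W) → ∃ n,
      (∀ q' z', AgreeOn n q q' → IsName q' z' → (g z').Nonempty → (g z' ∩ W).Nonempty) ∨
      (∀ q' z', AgreeOn n q q' → IsName q' z' → (g z').Nonempty → (g z' ∩ Wᶜ).Nonempty)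

/-- A problem with two continuous readings `β` and `t` of its solutions, and an instance arbitrarily
close to which there are instances forcing `t` to be any given point of `[0,1]`, arbitrarily close
to which there are instances forcing `β` to be `0` and instances forcing `β` to be `1`. -/
structure IsSplitting {X Y : Type} [Represented X] [Represented Y] (f : Multi X Y)
    (β t : Y → ℝ) : Prop where
  continuous_bit : NameContinuous β
  continuous_point : NameContinuous t
  exists_near : ∃ p₀ x₀, IsName p₀ x₀ ∧ (f x₀).Nonempty ∧
    ∀ n, ∀ y ∈ Icc (0 : ℝ) 1, ∃ p x, IsName p x ∧ (f x).Nonempty ∧ AgreeOn n p₀ p ∧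
      (∀ v ∈ f x, t v = y) ∧
      ∀ m, ∀ b ∈ ({0, 1} : Set ℝ), ∃ p' x', IsName p' x' ∧ (f x').Nonempty ∧ AgreeOn m p p' ∧
        ∀ v ∈ f x', β v = b

/-- Pigeonhole: with `k` points in `F`, the `k + 1` candidates `j / (k + 1)` are at least `1 / (k +
1)` apart, so each `c w` is within less than half that distance of at most one of them. It matters
that `δ` does not depend on `c`. -/
theorem exists_forall_le_abs_sub {ι : Type*} {F : Set ι} (hF : F.Finite) :
    ∃ δ > (0 : ℝ), ∀ c : ι → ℝ, ∃ y ∈ Icc (0 : ℝ) 1, ∀ w ∈ F, δ ≤ |y - c w| := by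
  classical
  lift F to Finset ι using hF
  set k := F.card
  have hk : (0 : ℝ) < k + 1 := by positivity
  refine ⟨1 / (2 * (k + 1)), by positivity, fun c => ?_⟩
  by_contra! hcon
  have hmem : ∀ j ∈ Finset.range (k + 1), ((j : ℝ) / (k + 1)) ∈ Icc (0 : ℝ) 1 := by
    intro j hj
    have : (j : ℝ) ≤ k + 1 := by exact_mod_cast (Finset.mem_range.1 hj).le
    exact ⟨by positivity, (div_le_one hk).2 this⟩
  have hex : ∀ j : ℕ, ∃ w, j ∈ Finset.range (k + 1) →
      w ∈ F ∧ |(j : ℝ) / (k + 1) - c w| < 1 / (2 * (k + 1)) := by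
    intro j
    by_cases hj : j ∈ Finset.range (k + 1)
    · obtain ⟨w, hw⟩ := hcon _ (hmem j hj)
      exact ⟨w, fun _ => hw⟩
    -- A junk value; it only shows that the index type is inhabited.
    · obtain ⟨w, -⟩ := hcon 0 (by simp)
      exact ⟨w, fun h => absurd h hj⟩
  choose w hw using hex
  obtain ⟨i, hi, j, hj, hij, heq⟩ := Finset.exists_ne_map_eq_of_card_lt_of_maps_to
    (s := Finset.range (k + 1)) (t := F) (by simp [k]) (f := w) fun j hj => (hw j hj).1
  have h1 := (hw i hi).2
  have h2 := (hw j hj).2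
  rw [heq] at h1
  have h3 : |(i : ℝ) / (k + 1) - j / (k + 1)| < 1 / (k + 1) := by
    have : (1 : ℝ) / (k + 1) = 1 / (2 * (k + 1)) + 1 / (2 * (k + 1)) := by field_simp; norm_num
    rw [abs_lt] at *
    constructor <;> linarith [h1.1, h1.2, h2.1, h2.2]
  rw [← sub_div, abs_div, abs_of_pos hk, div_lt_div_iff_of_pos_right hk] at h3
  have h4 : |(i : ℤ) - j| < 1 := by exact_mod_cast h3
  rw [Int.abs_lt_one_iff] at h4
  exact hij (by omega)

/-- A sphere in the interval has at most two points. This is where dimension one enters the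
separation argument. -/
theorem finite_frontier_ball (c : unitInterval) (r : ℝ) : (frontier (Metric.ball c r)).Finite := by
  refine Finite.subset ?_ Metric.frontier_ball_subset_sphere
  refine Finite.of_finite_image (f := ((↑) : unitInterval → ℝ)) ?_ Subtype.val_injective.injOn
  refine (Set.toFinite {(c : ℝ) + r, (c : ℝ) - r}).subset ?_
  rintro _ ⟨x, hx, rfl⟩
  rw [Metric.mem_sphere, Subtype.dist_eq, Real.dist_eq] at hx
  rcases abs_cases ((x : ℝ) - c) with h | h
  · left; linarith
  · right; simp only [mem_singleton_iff]; linarith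

theorem finite_frontier_union {X : Type*} [TopologicalSpace X] {s t : Set X}
    (hs : (frontier s).Finite) (ht : (frontier t).Finite) : (frontier (s ∪ t)).Finite :=
  (hs.union ht).subset <| (frontier_union_subset s t).trans <|
    union_subset_union inter_subset_left inter_subset_right

theorem finite_frontier_inter {X : Type*} [TopologicalSpace X] {s t : Set X}
    (hs : (frontier s).Finite) (ht : (frontier t).Finite) : (frontier (s ∩ t)).Finite :=
  (hs.union ht).subset <| (frontier_inter_subset s t).trans <|
    union_subset_union inter_subset_left inter_subset_right

theorem finite_frontier_nameNhd (p : Baire) (n : ℕ) :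
    (frontier (nameNhd unitInterval p n)).Finite := by
  induction n with
  | zero => simp [nameNhd]
  | succ n ih =>
    have : nameNhd unitInterval p (n + 1) =
        Metric.ball (DenseSeq.seq (p n)) ((1 / 2 : ℝ) ^ (n + 1)) ∩ nameNhd unitInterval p n := by
      simp only [nameNhd, Finset.range_add_one, Finset.set_biInter_insert]
    rw [this]
    exact finite_frontier_inter (finite_frontier_ball _ _) ih

/-- A problem with two independent readings does not reduce to a tame problem on `[0,1]`. -/
theorem IsSplitting.not_reducible {X Y Z : Type} [Represented X] [Represented Y] [Represented Z]
    {f : Multi X Y} {β t : Y → ℝ} {g : Multi Z unitInterval} (hf : IsSplitting f β t)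
    (hg : IsTame g) : ¬ Reducible f g := by
  intro hred
  obtain ⟨K, H, hK, hH, hKH⟩ := hred.exists_continuous
  obtain ⟨p₀, x₀, hp₀, hx₀, hnear⟩ := hf.exists_near
  obtain ⟨q₀, hq₀, z₀, hz₀, hne₀, hH₀⟩ := hKH p₀ x₀ hp₀ hx₀
  -- `Forces P m S`: if an instance agrees with `p₀` up to `m` and its image has a solution in `S`,
  -- then it has a solution satisfying `P`.
  let Forces (P : Y → Prop) (m : ℕ) (S : Set unitInterval) : Prop :=
    ∀ p x q z, AgreeOn m p₀ p → IsName p x → (f x).Nonempty → q ∈ K p → IsName q z →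
      (g z ∩ S).Nonempty → ∃ v ∈ f x, P v
  have forces_mono : ∀ {P m m' S S'}, Forces P m S → m ≤ m' → S' ⊆ S → Forces P m' S' :=
    fun h hm hS p x q z hp hx hne hq hz hS' =>
      h p x q z (hp.mono hm) hx hne hq hz (hS'.mono (inter_subset_inter_right _ hS))
  have forces_union : ∀ {P m S S'}, Forces P m S → Forces P m S' → Forces P m (S ∪ S') := by
    rintro P m S S' h h' p x q z hp hx hne hq hz ⟨w, hw, hS | hS⟩
    · exact h p x q z hp hx hne hq hz ⟨w, hw, hS⟩
    · exact h' p x q z hp hx hne hq hz ⟨w, hw, hS⟩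
  -- A finite part of `p₀` and of the open name `r` decides `h` of the output up to `ε`. Every point
  -- of `nameNhd` has a name sharing that part of `r`, so `H` must answer alike there.
  have local_forces : ∀ w ∈ g z₀, ∃ r, IsOpenName r w ∧ ∃ v ∈ f x₀, ∀ h : Y → ℝ,
      NameContinuous h → ∀ ε > 0, ∃ m, Forces (fun v' => |h v' - h v| < ε) m
        (nameNhd unitInterval r m) := by
    intro w hw
    obtain ⟨r, hr⟩ := exists_isOpenName w
    obtain ⟨s, hs, v, hv, hsv⟩ := hH₀ r w hw hr.isName
    refine ⟨r, hr, v, hv, fun h hh ε hε => ?_⟩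
    obtain ⟨n, hn⟩ := hh s v hsv ε hε
    obtain ⟨m, hm⟩ := hH.exists_modulus hs n
    refine ⟨m, ?_⟩
    rintro p x q z hp hx hne hq hz ⟨w', hw', hS⟩
    obtain ⟨r', hr', hrr⟩ := exists_isOpenName_of_mem_nameNhd hS
    obtain ⟨q', hq', z', hz', -, hH'⟩ := hKH p x hx hne
    obtain rfl := Part.mem_unique hq hq'
    obtain rfl := unique hz hz'
    obtain ⟨s', hs', v', hv', hsv'⟩ := hH' r' w' hw' hr'.isName
    exact ⟨v', hv', hn s' v' (hm _ _ (hp.pair hrr) hs') hsv'⟩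
  have stable : ∀ W, IsOpen W → g z₀ ⊆ W → ∃ m, ∀ p q z, AgreeOn m p₀ p → q ∈ K p →
      IsName q z → (g z).Nonempty → g z ⊆ W := by
    intro W hW hsub
    obtain ⟨n, hn⟩ := hg.subset_stable q₀ z₀ hz₀ hne₀ W hW hsub
    obtain ⟨m, hm⟩ := hK.exists_modulus hq₀ n
    exact ⟨m, fun p q z hp hq hz hne => hn q z (hm p q hp hq) hz hne⟩
  -- Compactness induction: a point goes to `W₀` or `W₁` according to whether the reading `β` of its
  -- answer is below `1/2`. Only the frontier of `W₀` will be examined.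
  have cover : ∃ W₀ W₁ m, IsOpen W₀ ∧ IsOpen W₁ ∧ (frontier W₀).Finite ∧ g z₀ ⊆ W₀ ∪ W₁ ∧
      Forces (fun v => β v < 1) m W₀ ∧ Forces (fun v => 0 < β v) m W₁ := by
    refine (hg.isClosed z₀).isCompact.induction_on
      (p := fun S => ∃ W₀ W₁ m, IsOpen W₀ ∧ IsOpen W₁ ∧ (frontier W₀).Finite ∧ S ⊆ W₀ ∪ W₁ ∧
        Forces (fun v => β v < 1) m W₀ ∧ Forces (fun v => 0 < β v) m W₁) ?_ ?_ ?_ ?_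
    · refine ⟨∅, ∅, 0, isOpen_empty, isOpen_empty, by simp, by simp, ?_, ?_⟩
      · rintro _ _ _ _ _ _ _ _ _ ⟨w, -, hw⟩; exact hw.elim
      · rintro _ _ _ _ _ _ _ _ _ ⟨w, -, hw⟩; exact hw.elim
    · rintro S S' hS ⟨W₀, W₁, m, h0, h1, hfr, hsub, hF⟩
      exact ⟨W₀, W₁, m, h0, h1, hfr, hS.trans hsub, hF⟩
    · rintro S S' ⟨W₀, W₁, m, h0, h1, hfr, hsub, hF0, hF1⟩
        ⟨W₀', W₁', m', h0', h1', hfr', hsub', hF0', hF1'⟩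
      refine ⟨W₀ ∪ W₀', W₁ ∪ W₁', max m m', h0.union h0', h1.union h1',
        finite_frontier_union hfr hfr', ?_,
        forces_union (forces_mono hF0 (le_max_left _ _) le_rfl)
          (forces_mono hF0' (le_max_right _ _) le_rfl),
        forces_union (forces_mono hF1 (le_max_left _ _) le_rfl)
          (forces_mono hF1' (le_max_right _ _) le_rfl)⟩
      rw [union_union_union_comm]
      exact union_subset_union hsub hsub'
    · intro w hw
      obtain ⟨r, hr, v, -, hloc⟩ := local_forces w hw
      obtain ⟨m, hm⟩ := hloc β hf.continuous_bit (1 / 2) (by norm_num)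
      have hnhds := mem_nhdsWithin_of_mem_nhds (t := g z₀)
        ((isOpen_nameNhd r m).mem_nhds (hr.mem_nameNhd m))
      have hempty : ∀ P, Forces P m ∅ := by
        rintro _ _ _ _ _ _ _ _ _ _ ⟨w, -, hw⟩; exact hw.elim
      refine ⟨_, hnhds, ?_⟩
      rcases lt_or_ge (β v) (1 / 2) with hb | hb
      · refine ⟨nameNhd unitInterval r m, ∅, m, isOpen_nameNhd r m, isOpen_empty,
          finite_frontier_nameNhd r m, by simp, ?_, hempty _⟩
        intro p x q z hp hx hne hq hz hS
        obtain ⟨v', hv', hd⟩ := hm p x q z hp hx hne hq hz hS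
        exact ⟨v', hv', by linarith [(abs_lt.1 hd).2]⟩
      · refine ⟨∅, nameNhd unitInterval r m, m, isOpen_empty, isOpen_nameNhd r m,
          by simp, by simp, hempty _, ?_⟩
        intro p x q z hp hx hne hq hz hS
        obtain ⟨v', hv', hd⟩ := hm p x q z hp hx hne hq hz hS
        exact ⟨v', hv', by linarith [(abs_lt.1 hd).1]⟩
  obtain ⟨W₀, W₁, m₁, hW₀, hW₁, hfin, hcov, hF₀, hF₁⟩ := cover
  obtain ⟨m₂, hm₂⟩ := stable _ (hW₀.union hW₁) hcov
  obtain ⟨δ, hδ, hy⟩ := exists_forall_le_abs_sub hfin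
  -- A point outside `g z₀` is avoided by all nearby solution sets, so forcing is vacuous there and
  -- the value 0 is arbitrary.
  have frontier_forces : ∀ w, ∃ c : ℝ, ∃ m, Forces (fun v => |t v - c| < δ) m {w} := by
    intro w
    by_cases hw : w ∈ g z₀
    · obtain ⟨r, hr, v, -, hloc⟩ := local_forces w hw
      obtain ⟨m, hm⟩ := hloc t hf.continuous_point δ hδ
      exact ⟨t v, m, forces_mono hm le_rfl (singleton_subset_iff.2 (hr.mem_nameNhd m))⟩
    · obtain ⟨m, hm⟩ := stable {w}ᶜ isOpen_compl_singleton (by simpa using hw)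
      refine ⟨0, m, ?_⟩
      rintro p x q z hp hx hne hq hz ⟨w', hw', rfl⟩
      exact absurd rfl (hm p q z hp hq hz ⟨w', hw'⟩ hw')
  choose c mF hmF using frontier_forces
  obtain ⟨y, hyI, hyc⟩ := hy c
  obtain ⟨m₃, hm₃⟩ := (hfin.image mF).bddAbove
  set N := max m₁ (max m₂ m₃)
  obtain ⟨p, x, hp, hx, hpp, hty, hnear'⟩ := hnear N y hyI
  obtain ⟨q, hq, z, hz, hne, -⟩ := hKH p x hp hx
  -- A solution on the frontier would give a solution of `x` with `t` within `δ` of `c w`, whereas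
  -- `t` is forced to be `y`.
  have hdisj : Disjoint (g z) (frontier W₀) := by
    rw [Set.disjoint_left]
    intro w hw hwF
    have hle : mF w ≤ N := (hm₃ (mem_image_of_mem _ hwF)).trans (by simp [N])
    obtain ⟨v, hv, hlt⟩ := hmF w p x q z (hpp.mono hle) hp hx hq hz ⟨w, hw, rfl⟩
    rw [hty v hv] at hlt
    exact absurd hlt (not_lt.2 (hyc w hwF))
  obtain ⟨n, hn⟩ := hg.inter_stable q z hz hne W₀ hW₀ hfin hdisj
  obtain ⟨m, hm⟩ := hK.exists_modulus hq n
  rcases hn with hn | hn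
  · obtain ⟨p', x', hp', hx', hpp', hβ⟩ := hnear' (max m N) 1 (by simp)
    obtain ⟨q', hq', z', hz', hne', -⟩ := hKH p' x' hp' hx'
    have hS := hn q' z' (hm _ _ (hpp'.mono (le_max_left _ _)) hq') hz' hne'
    have hag := hpp.trans (hpp'.mono (le_max_right m N))
    obtain ⟨v, hv, hlt⟩ := hF₀ p' x' q' z' (hag.mono (by simp [N])) hp' hx' hq' hz' hS
    exact absurd (hβ v hv) hlt.ne
  · obtain ⟨p', x', hp', hx', hpp', hβ⟩ := hnear' (max m N) 0 (by simp)
    obtain ⟨q', hq', z', hz', hne', -⟩ := hKH p' x' hp' hx'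
    obtain ⟨w, hw, hwc⟩ := hn q' z' (hm _ _ (hpp'.mono (le_max_left _ _)) hq') hz' hne'
    have hag := hpp.trans (hpp'.mono (le_max_right m N))
    -- The solution lies outside `W₀`, but all solutions remain in `W₀ ∪ W₁`.
    have hw₁ : w ∈ W₁ :=
      (hm₂ p' q' z' (hag.mono (by simp [N])) hq' hz' hne' hw).resolve_left hwc
    obtain ⟨v, hv, hlt⟩ := hF₁ p' x' q' z' (hag.mono (by simp [N])) hp' hx' hq' hz' ⟨w, hw, hw₁⟩
    exact absurd (hβ v hv) hlt.ne'

/-! ### Connected choice and the intermediate value theorem are tame -/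

/-- By compactness finitely many of the listed balls already cover `Wᶜ`, and any name sharing that
prefix lists them too. -/
theorem closeds_subset_stable {X : Type} [MetricSpace X] [CompactSpace X] [DenseSeq X] {q : Baire}
    {A : Closeds X} (hq : IsName q A) {W : Set X} (hW : IsOpen W) (hA : (A : Set X) ⊆ W) :
    ∃ n, ∀ q' (A' : Closeds X), AgreeOn n q q' → IsName q' A' → (A' : Set X) ⊆ W := by
  have hq : (A : Set X)ᶜ = ⋃ i, ratBall X (q i) := hq
  have hsub : Wᶜ ⊆ ⋃ i, ratBall X (q i) := hq ▸ compl_subset_compl.2 hA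
  obtain ⟨s, hs⟩ := hW.isClosed_compl.isCompact.elim_finite_subcover _
    (fun _ => Metric.isOpen_ball) hsub
  obtain ⟨n, hn⟩ := s.bddAbove
  refine ⟨n + 1, fun q' A' hqq (hq' : (A' : Set X)ᶜ = ⋃ i, ratBall X (q' i)) => ?_⟩
  rw [← compl_subset_compl, hq']
  refine hs.trans (iUnion₂_subset fun i hi => ?_)
  rw [hqq i (Nat.lt_succ_of_le (hn hi))]
  exact subset_iUnion (fun i => ratBall X (q' i)) i

theorem connectedChoice_eq {X : Type} [MetricSpace X] {A : Closeds X}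
    (h : (connectedChoice X A).Nonempty) :
    connectedChoice X A = A ∧ IsConnected (A : Set X) := by
  obtain ⟨x, -, hc⟩ := h
  exact ⟨by ext y; simp [connectedChoice, hc], hc⟩

/-- Off the frontier, `W` and its exterior are disjoint open sets covering `C`. -/
theorem subset_of_disjoint_frontier {X : Type*} [TopologicalSpace X] {C W : Set X}
    (hC : IsPreconnected C) (hW : IsOpen W) (hdisj : Disjoint C (frontier W))
    (hne : (C ∩ W).Nonempty) : C ⊆ W := by
  have hcl : ∀ x ∈ C, x ∈ closure W → x ∈ W := fun x hx hxW => by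
    by_contra h
    exact Set.disjoint_left.1 hdisj hx (hW.frontier_eq ▸ ⟨hxW, h⟩)
  intro x hx
  by_contra hxW
  obtain ⟨y, -, hyW, hyc⟩ := hC W (closure W)ᶜ hW isClosed_closure.isOpen_compl
    (fun y hy => (em (y ∈ closure W)).imp (hcl y hy) id) hne ⟨x, hx, fun h => hxW (hcl x hx h)⟩
  exact hyc (subset_closure hyW)

/-- A connected solution set missing the frontier lies in `W` or in the exterior of `W`. Both are
open, so upper semicontinuity keeps nearby solution sets on the same side. -/
theorem isTame_connectedChoice : IsTame (connectedChoice unitInterval) := by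
  have hsub : ∀ q (z : Closeds unitInterval), IsName q z →
      (connectedChoice unitInterval z).Nonempty → ∀ W, IsOpen W →
      connectedChoice unitInterval z ⊆ W →
      ∃ n, ∀ q' z', AgreeOn n q q' → IsName q' z' → (connectedChoice unitInterval z').Nonempty →
        connectedChoice unitInterval z' ⊆ W := by
    intro q z hz hne W hW hzW
    rw [(connectedChoice_eq hne).1] at hzW
    obtain ⟨n, hn⟩ := closeds_subset_stable hz hW hzW
    exact ⟨n, fun q' z' hqq hz' _ => fun x hx => hn q' z' hqq hz' hx.1⟩
  refine ⟨fun z => ?_, hsub, ?_⟩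
  · rcases (connectedChoice unitInterval z).eq_empty_or_nonempty with h | h
    · rw [h]; exact isClosed_empty
    · rw [(connectedChoice_eq h).1]; exact z.isClosed
  · intro q z hz hne W hW _ hdisj
    have hconn := (connectedChoice_eq hne).2
    rw [← (connectedChoice_eq hne).1] at hconn
    by_cases hWz : (connectedChoice unitInterval z ∩ W).Nonempty
    · have hzW := subset_of_disjoint_frontier hconn.isPreconnected hW hdisj hWz
      obtain ⟨n, hn⟩ := hsub q z hz hne W hW hzW
      exact ⟨n, Or.inl fun q' z' hqq hz' hne' =>
        (inter_eq_left.2 (hn q' z' hqq hz' hne')).symm ▸ hne'⟩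
    · have hzW : connectedChoice unitInterval z ⊆ (closure W)ᶜ := by
        intro w hw hwW
        refine (Set.disjoint_left.1 hdisj) hw ?_
        rw [hW.frontier_eq]
        exact ⟨hwW, fun h => hWz ⟨w, hw, h⟩⟩
      obtain ⟨n, hn⟩ := hsub q z hz hne _ isClosed_closure.isOpen_compl hzW
      refine ⟨n, Or.inr fun q' z' hqq hz' hne' => ?_⟩
      rw [inter_eq_left.2 ((hn q' z' hqq hz' hne').trans (compl_subset_compl.2 subset_closure))]
      exact hne'

theorem exists_abs_sub_lt_of_isName {q : Baire} {f : C(unitInterval, ℝ)} (hq : IsName q f) {ε : ℝ}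
    (hε : 0 < ε) :
    ∃ n, ∀ q' (f' : C(unitInterval, ℝ)), AgreeOn n q q' → IsName q' f' →
      ∀ x, |f' x - f x| < ε := by
  obtain ⟨n, hn⟩ := exists_dist_lt_of_isName hq hε
  exact ⟨n, fun q' f' hqq hf' x =>
    (ContinuousMap.dist_apply_le_dist x).trans_lt (hn q' f' hqq hf')⟩

theorem IVT_eq {f : C(unitInterval, ℝ)} (h : (IVT f).Nonempty) :
    IVT f = {x | f x = 0} ∧ f 0 * f 1 < 0 := by
  obtain ⟨x, hc, -⟩ := h
  exact ⟨by ext y; simp [IVT, hc], hc⟩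

theorem mul_neg_of_abs_sub_lt {a b a' b' : ℝ} (hab : a * b < 0) (ha : |a' - a| < |a|)
    (hb : |b' - b| < |b|) : a' * b' < 0 := by
  rcases mul_neg_iff.1 hab with ⟨h1, h2⟩ | ⟨h1, h2⟩
  · rw [abs_of_pos h1, abs_lt] at ha
    rw [abs_of_neg h2, abs_lt] at hb
    exact mul_neg_of_pos_of_neg (by linarith) (by linarith)
  · rw [abs_of_neg h1, abs_lt] at ha
    rw [abs_of_pos h2, abs_lt] at hb
    exact mul_neg_of_neg_of_pos (by linarith) (by linarith)

theorem exists_zero_mem_Ioo {f : C(unitInterval, ℝ)} {a b : unitInterval} (hab : a < b)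
    (h : f a * f b < 0) : ∃ x ∈ Ioo a b, f x = 0 := by
  obtain ⟨x, hx, hx0⟩ : ∃ x ∈ Icc a b, f x = 0 := by
    rcases mul_neg_iff.1 h with ⟨h1, h2⟩ | ⟨h1, h2⟩
    · exact intermediate_value_Icc' hab.le f.continuous.continuousOn ⟨h2.le, h1.le⟩
    · exact intermediate_value_Icc hab.le f.continuous.continuousOn ⟨h1.le, h2.le⟩
  refine ⟨x, ⟨hx.1.lt_of_ne ?_, hx.2.lt_of_ne ?_⟩, hx0⟩
  · rintro rfl; simp [hx0] at h
  · rintro rfl; simp [hx0] at h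

/-- If `f` changes sign and has no zeros on a finite set `F`, then it changes sign between two
points that are not separated by `F`. -/
theorem exists_sign_change_disjoint {f : C(unitInterval, ℝ)} (hf : f 0 * f 1 < 0)
    {F : Set unitInterval} (hF : F.Finite) (hF0 : ∀ x ∈ F, f x ≠ 0) :
    ∃ a b, a < b ∧ f a * f b < 0 ∧ Disjoint (Ioo a b) F := by
  set F' := insert 0 (insert 1 F)
  have hF' : F'.Finite := (hF.insert 1).insert 0
  set S := {u : unitInterval × unitInterval | u ∈ F' ×ˢ F' ∧ u.1 < u.2 ∧ f u.1 * f u.2 < 0}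
  have hS : S.Finite := (hF'.prod hF').subset fun u hu => hu.1
  have hne : S.Nonempty := ⟨(0, 1), by simp [F'], zero_lt_one, hf⟩
  -- Take a closest pair with a sign change. Since `f` is nonzero on `F`, a point of `F` strictly
  -- between would give a closer pair.
  obtain ⟨⟨a, b⟩, ⟨⟨ha, hb⟩, hab, hneg⟩, hmin⟩ :=
    Set.exists_min_image S (fun u => (u.2 : ℝ) - u.1) hS hne
  refine ⟨a, b, hab, hneg, Set.disjoint_left.2 fun c hc hcF => ?_⟩
  have hcF' : c ∈ F' := by simp [F', hcF]
  have hc1 : (a : ℝ) < c := hc.1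
  have hc2 : (c : ℝ) < b := hc.2
  have hc0 : 0 < f c * f c := mul_self_pos.2 (hF0 c hcF)
  rcases lt_or_ge (f a * f c) 0 with h | h
  · have := hmin (a, c) ⟨⟨ha, hcF'⟩, hc.1, h⟩
    simp only at this
    linarith
  · have h' : f c * f b < 0 := by
      by_contra! hcon
      nlinarith [mul_nonneg h hcon]
    have := hmin (c, b) ⟨⟨hcF', hb⟩, hc.2, h'⟩
    simp only at this
    linarith

/-- Single zeros may vanish under perturbation, but a sign change between `a` and `b` survives. The
interval between them misses the frontier, hence lies in `W` or in its complement, and so does the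
zero it provides. -/
theorem isTame_IVT : IsTame IVT := by
  refine ⟨fun f => ?_, ?_, ?_⟩
  · rcases (IVT f).eq_empty_or_nonempty with h | h
    · rw [h]; exact isClosed_empty
    · rw [(IVT_eq h).1]; exact isClosed_eq f.continuous continuous_const
  · intro q f hq hne W hW hfW
    -- Off `W` the function is bounded away from 0, so uniformly close functions have no zeros
    -- there.
    rw [(IVT_eq hne).1] at hfW
    obtain ⟨ε, hε, hle⟩ : ∃ ε > 0, ∀ x ∈ Wᶜ, ε ≤ |f x| := by
      rcases (Wᶜ).eq_empty_or_nonempty with h | h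
      · exact ⟨1, one_pos, by simp [h]⟩
      · obtain ⟨x, hx, hmin⟩ := hW.isClosed_compl.isCompact.exists_isMinOn h
          (f.continuous.abs.continuousOn)
        exact ⟨|f x|, abs_pos.2 fun h0 => hx (hfW h0), fun y hy => hmin hy⟩
    obtain ⟨n, hn⟩ := exists_abs_sub_lt_of_isName hq hε
    refine ⟨n, fun q' f' hqq hq' _ x hx => ?_⟩
    by_contra hxW
    have h1 := hn q' f' hqq hq' x
    rw [hx.2, zero_sub, abs_neg] at h1
    exact absurd h1 (not_lt.2 (hle x hxW))
  · intro q f hq hne W hW hfin hdisj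
    obtain ⟨heq, hneg⟩ := IVT_eq hne
    rw [heq] at hdisj
    obtain ⟨a, b, hab, hfab, hF⟩ := exists_sign_change_disjoint hneg hfin
      fun x hx h0 => Set.disjoint_left.1 hdisj h0 hx
    have hfa : f a ≠ 0 := by rintro h; simp [h] at hfab
    have hfb : f b ≠ 0 := by rintro h; simp [h] at hfab
    obtain ⟨n, hn⟩ := exists_abs_sub_lt_of_isName hq (lt_min (abs_pos.2 hfa) (abs_pos.2 hfb))
    have hzero : ∀ q' f', AgreeOn n q q' → IsName q' f' → (IVT f').Nonempty →
        (IVT f' ∩ Ioo a b).Nonempty := by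
      intro q' f' hqq hq' hne'
      obtain ⟨x, hx, hx0⟩ := exists_zero_mem_Ioo hab (mul_neg_of_abs_sub_lt hfab
        ((hn q' f' hqq hq' a).trans_le (min_le_left _ _))
        ((hn q' f' hqq hq' b).trans_le (min_le_right _ _)))
      exact ⟨x, by rw [(IVT_eq hne').1]; exact hx0, hx⟩
    by_cases hW' : Ioo a b ⊆ W
    · exact ⟨n, Or.inl fun q' f' hqq hq' hne' =>
        (hzero q' f' hqq hq' hne').mono (inter_subset_inter_right _ hW')⟩
    · refine ⟨n, Or.inr fun q' f' hqq hq' hne' =>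
        (hzero q' f' hqq hq' hne').mono (inter_subset_inter_right _ ?_)⟩
      exact fun x hx hxW =>
        hW' (subset_of_disjoint_frontier isPreconnected_Ioo hW hF ⟨x, hx, hxW⟩)

/-! ### Choice problems -/

theorem exists_ratBall_eq_empty (X : Type) [MetricSpace X] [DenseSeq X] :
    ∃ e, ratBall X e = ∅ := by
  obtain ⟨z, hz⟩ := ratOfNat_surjective 0
  exact ⟨Nat.pair 0 z, by simp [ratBall, hz]⟩

/-- The whole space has a name every prefix of which extends to a name of any closed set. -/
theorem exists_isName_top (X : Type) [MetricSpace X] [DenseSeq X] :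
    ∃ p, IsName p (⊤ : Closeds X) ∧ ∀ (A : Closeds X) n, ∃ p', IsName p' A ∧ AgreeOn n p p' := by
  obtain ⟨e, he⟩ := exists_ratBall_eq_empty X
  -- Listing only empty balls excludes nothing yet, so any closed set can still follow.
  refine ⟨fun _ => e, ?_, fun A n => ?_⟩
  · change ((⊤ : Closeds X) : Set X)ᶜ = ⋃ _ : ℕ, ratBall X e
    simp [he]
  · obtain ⟨q, hq⟩ := surj A
    have hq : (A : Set X)ᶜ = ⋃ i, ratBall X (q i) := hq
    refine ⟨fun i => if i < n then e else q (i - n), ?_, fun i hi => by simp [hi]⟩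
    change (A : Set X)ᶜ = ⋃ i, ratBall X (if i < n then e else q (i - n))
    rw [hq]
    refine Subset.antisymm (iUnion_subset fun i => ?_) (iUnion_subset fun i => ?_)
    · refine subset_iUnion_of_subset (i + n) ?_
      simp
    · split_ifs
      · simp [he]
      · exact subset_iUnion (fun i => ratBall X (q i)) (i - n)

/-- The closed set `{x}`. -/
def closedPoint {X : Type} [MetricSpace X] (x : X) : Closeds X := ⟨{x}, isClosed_singleton⟩

theorem allOrUniqueChoice_top (X : Type) [MetricSpace X] : allOrUniqueChoice X ⊤ = univ := by
  ext x; simp [allOrUniqueChoice]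

theorem allOrUniqueChoice_closedPoint {X : Type} [MetricSpace X] (x : X) :
    allOrUniqueChoice X (closedPoint x) = {x} := by
  ext y
  refine ⟨fun h => h.1, fun h => ⟨h, Or.inr ⟨x, rfl⟩⟩⟩

theorem closedChoice_top (X : Type) [MetricSpace X] : closedChoice X ⊤ = univ := rfl

theorem closedChoice_closedPoint {X : Type} [MetricSpace X] (x : X) :
    closedChoice X (closedPoint x) = {x} := rfl

/-- Start with nothing excluded in either factor; shrink the second to `{y}`, and only later the
first to `{b}`. -/
theorem isSplitting_prod :
    IsSplitting ((closedChoice Two).prod (allOrUniqueChoice unitInterval))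
      (fun v => ((v.1 : ℕ) : ℝ)) (fun v => (v.2 : ℝ)) where
  continuous_bit := by
    have : Continuous fun a : Two => ((a : ℕ) : ℝ) := by fun_prop
    exact (nameContinuous_of_continuous this).comp_fst
  continuous_point := (nameContinuous_of_continuous continuous_subtype_val).comp_snd
  exists_near := by
    obtain ⟨p, hp, hpn⟩ := exists_isName_top Two
    obtain ⟨q, hq, hqn⟩ := exists_isName_top unitInterval
    have hname : ∀ {p q : Baire} {A : Closeds Two} {B : Closeds unitInterval},
        IsName p A → IsName q B → IsName (p.pair q) (A, B) := fun {p q A B} h h' =>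
      ⟨by rwa [Baire.fst_pair], by rwa [Baire.snd_pair]⟩
    refine ⟨p.pair q, (⊤, ⊤), hname hp hq, ⟨(⟨0, two_pos⟩, 0), ?_⟩, fun n y hy => ?_⟩
    · simp [Multi.prod, closedChoice_top, allOrUniqueChoice_top]
    obtain ⟨q', hq', hqq⟩ := hqn (closedPoint ⟨y, hy⟩) n
    refine ⟨p.pair q', (⊤, closedPoint ⟨y, hy⟩), hname hp hq', ⟨(⟨0, two_pos⟩, ⟨y, hy⟩), ?_⟩,
      (AgreeOn.refl n p).pair hqq, ?_, fun m b hb => ?_⟩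
    · simp [Multi.prod, closedChoice_top, allOrUniqueChoice_closedPoint]
    · rintro ⟨v, w⟩ ⟨-, hw⟩
      simp only [allOrUniqueChoice_closedPoint, mem_singleton_iff] at hw
      simp [hw]
    · obtain ⟨k, hk, rfl⟩ : ∃ k : ℕ, k < 2 ∧ b = k := by
        rcases hb with rfl | rfl
        · exact ⟨0, by simp⟩
        · exact ⟨1, by simp⟩
      obtain ⟨p', hp', hpp⟩ := hpn (closedPoint ⟨k, hk⟩) m
      refine ⟨p'.pair q', (closedPoint ⟨k, hk⟩, closedPoint ⟨y, hy⟩), hname hp' hq',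
        ⟨(⟨k, hk⟩, ⟨y, hy⟩), ?_⟩, hpp.pair (AgreeOn.refl m q'), ?_⟩
      · simp [Multi.prod, closedChoice_closedPoint, allOrUniqueChoice_closedPoint]
      · rintro ⟨v, w⟩ ⟨hv, -⟩
        simp only [closedChoice_closedPoint, mem_singleton_iff] at hv
        simp [hv]

/-- The square suffices: the second coordinate is shrunk to `{y}`, then the first to an endpoint of
[0,1], which serves as the bit. -/
theorem isSplitting_star :
    IsSplitting (allOrUniqueChoice unitInterval).star
      (fun v => coordValue ((↑) : unitInterval → ℝ) 0 v.2)
      (fun v => coordValue ((↑) : unitInterval → ℝ) 1 v.2) where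
  continuous_bit := NameContinuous.sigma fun n =>
    (nameContinuous_of_continuous continuous_subtype_val).coordValue 0 n
  continuous_point := NameContinuous.sigma fun n =>
    (nameContinuous_of_continuous continuous_subtype_val).coordValue 1 n
  exists_near := by
    obtain ⟨p, hp, hpn⟩ := exists_isName_top unitInterval
    let code (p q : Baire) : Baire := Baire.cons 2 (Baire.tuple fun i => if i = 0 then p else q)
    let inst (A B : Closeds unitInterval) : Σ n : ℕ, Fin n → Closeds unitInterval := ⟨2, ![A, B]⟩
    have hname : ∀ {p q : Baire} {A B : Closeds unitInterval},
        IsName p A → IsName q B → IsName (code p q) (inst A B) := by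
      intro p q A B h h'
      refine ⟨rfl, ?_⟩
      rw [Baire.tail_cons]
      intro i
      rw [Baire.comp_tuple]
      fin_cases i
      · simpa [inst] using h
      · simpa [inst] using h'
    have hcode : ∀ {n p p' q q'}, AgreeOn n p p' → AgreeOn n q q' →
        AgreeOn n (code p q) (code p' q') := fun {n p p' q q'} h h' =>
      (AgreeOn.tuple fun i => by by_cases hi : i = 0 <;> simpa [hi]).cons 2
    have hmem : ∀ {A B : Closeds unitInterval} {v},
        v ∈ (allOrUniqueChoice unitInterval).star (inst A B) ↔
          ∃ a ∈ allOrUniqueChoice unitInterval A, ∃ b ∈ allOrUniqueChoice unitInterval B,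
            v = ⟨2, ![a, b]⟩ := by
      intro A B v
      constructor
      · rintro ⟨u, hu, rfl⟩
        refine ⟨u 0, hu 0, u 1, hu 1, ?_⟩
        congr 1
        funext i
        fin_cases i <;> rfl
      · rintro ⟨a, ha, b, hb, rfl⟩
        refine ⟨![a, b], fun i => ?_, rfl⟩
        fin_cases i
        · exact ha
        · exact hb
    have hne : ∀ {A B : Closeds unitInterval} {a b}, a ∈ allOrUniqueChoice unitInterval A →
        b ∈ allOrUniqueChoice unitInterval B →
        ((allOrUniqueChoice unitInterval).star (inst A B)).Nonempty :=
      fun {A B a b} ha hb => ⟨_, hmem.2 ⟨a, ha, b, hb, rfl⟩⟩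
    have hpt : ∀ x : unitInterval, x ∈ allOrUniqueChoice unitInterval (closedPoint x) := by
      simp [allOrUniqueChoice_closedPoint]
    have htop : (0 : unitInterval) ∈ allOrUniqueChoice unitInterval ⊤ := by
      simp [allOrUniqueChoice_top]
    refine ⟨code p p, inst ⊤ ⊤, hname hp hp, hne htop htop, fun n y hy => ?_⟩
    obtain ⟨q, hq, hpq⟩ := hpn (closedPoint ⟨y, hy⟩) n
    refine ⟨code p q, inst ⊤ (closedPoint ⟨y, hy⟩), hname hp hq, hne htop (hpt _),
      hcode (AgreeOn.refl n p) hpq, ?_, fun m b hb => ?_⟩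
    · intro v hv
      obtain ⟨a, -, b, hb, rfl⟩ := hmem.1 hv
      rw [allOrUniqueChoice_closedPoint, mem_singleton_iff] at hb
      simp [coordValue, hb]
    · have hbI : b ∈ Icc (0 : ℝ) 1 := by rcases hb with rfl | rfl <;> simp
      obtain ⟨p', hp', hpp⟩ := hpn (closedPoint ⟨b, hbI⟩) m
      refine ⟨code p' q, inst (closedPoint ⟨b, hbI⟩) (closedPoint ⟨y, hy⟩), hname hp' hq,
        hne (hpt _) (hpt _), hcode hpp (AgreeOn.refl m q), ?_⟩
      intro v hv
      obtain ⟨a, ha, b', -, rfl⟩ := hmem.1 hv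
      rw [allOrUniqueChoice_closedPoint, mem_singleton_iff] at ha
      simp [coordValue, ha]

/-! ### Nash equilibria -/

/-- Every point has a name such that each of its prefixes extends to such names of all points
nearby. -/
def HasOpenNames (X : Type) [TopologicalSpace X] [Represented X] : Prop :=
  ∃ Good : Baire → X → Prop, (∀ p x, Good p x → IsName p x) ∧ (∀ x, ∃ p, Good p x) ∧
    ∀ p x n, Good p x → ∀ᶠ x' in nhds x, ∃ p', Good p' x' ∧ AgreeOn n p p'

theorem hasOpenNames_of_metricSpace (X : Type) [MetricSpace X] [DenseSeq X] : HasOpenNames X :=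
  ⟨IsOpenName, fun _ _ h => h.isName, exists_isOpenName, fun p _ n h =>
    Filter.mem_of_superset ((isOpen_nameNhd p n).mem_nhds (h.mem_nameNhd n))
      fun _ hx => exists_isOpenName_of_mem_nameNhd hx⟩

theorem HasOpenNames.prod {X Y : Type} [TopologicalSpace X] [Represented X] [TopologicalSpace Y]
    [Represented Y] (hX : HasOpenNames X) (hY : HasOpenNames Y) : HasOpenNames (X × Y) := by
  obtain ⟨G, hG, hGs, hGn⟩ := hX
  obtain ⟨G', hG', hGs', hGn'⟩ := hY
  refine ⟨fun p u => G p.fst u.1 ∧ G' p.snd u.2, fun p u h => ⟨hG _ _ h.1, hG' _ _ h.2⟩,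
    fun u => ?_, ?_⟩
  · obtain ⟨p, hp⟩ := hGs u.1
    obtain ⟨q, hq⟩ := hGs' u.2
    exact ⟨p.pair q, by rwa [Baire.fst_pair], by rwa [Baire.snd_pair]⟩
  · rintro p ⟨x, y⟩ n ⟨h, h'⟩
    rw [nhds_prod_eq]
    filter_upwards [(hGn _ _ n h).prod_mk (hGn' _ _ n h')]
    rintro ⟨x', y'⟩ ⟨⟨q, hq, hpq⟩, q', hq', hpq'⟩
    refine ⟨q.pair q', ⟨by rwa [Baire.fst_pair], by rwa [Baire.snd_pair]⟩, ?_⟩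
    have hp : p.fst.pair p.snd = p := by
      funext i
      simp only [Baire.pair, Baire.fst, Baire.snd]
      split_ifs with hi <;> congr 1 <;> omega
    have := hpq.pair hpq'
    rwa [hp] at this

theorem HasOpenNames.pow {X : Type} [TopologicalSpace X] [Represented X] (hX : HasOpenNames X)
    (k : ℕ) : HasOpenNames (Fin k → X) := by
  obtain ⟨G, hG, hGs, hGn⟩ := hX
  refine ⟨fun p u => ∀ i : Fin k, G (p.comp i) (u i), fun p u h i => hG _ _ (h i), fun u => ?_, ?_⟩
  · choose q hq using fun i => hGs (u i)
    refine ⟨Baire.tuple fun i => if hi : i < k then q ⟨i, hi⟩ else 0, fun i => ?_⟩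
    rw [Baire.comp_tuple]
    simpa using hq i
  · intro p u n h
    have hev : ∀ᶠ u' in nhds u, ∀ i : Fin k, ∃ p', G p' (u' i) ∧ AgreeOn n (p.comp i) p' :=
      Filter.eventually_all.2 fun i => (continuous_apply i).continuousAt.eventually (hGn _ _ n (h i))
    filter_upwards [hev] with u' hu'
    choose q hq hpq using hu'
    -- Components beyond `k` name nothing, but must be copied from `p` to keep the prefix.
    refine ⟨Baire.tuple fun i => if hi : i < k then q ⟨i, hi⟩ else p.comp i, fun i => ?_, ?_⟩
    · rw [Baire.comp_tuple]
      simpa using hq i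
    · have hp : Baire.tuple p.comp = p := by
        funext j; simp [Baire.tuple, Baire.comp]
      have : AgreeOn n (Baire.tuple p.comp)
          (Baire.tuple fun i => if hi : i < k then q ⟨i, hi⟩ else p.comp i) := by
        refine AgreeOn.tuple fun i => ?_
        split_ifs with hi
        · exact hpq ⟨i, hi⟩
        · exact AgreeOn.refl n _
      rwa [hp] at this

theorem hasOpenNames_matrix (n m : ℕ) : HasOpenNames (Matrix (Fin n) (Fin m) ℝ) :=
  ((hasOpenNames_of_metricSpace ℝ).pow m).pow n

/-- The payoffs of the row player, whose strategies are the pairs of a side in a game of matching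
pennies at stakes `ε` and a bit, with the bonus `c` for the bit `1`. -/
def rowPayoff (ε c : ℝ) : Matrix (Fin 4) (Fin 2) ℝ :=
  !![ε + c, -ε + c; ε, -ε; -ε + c, ε + c; -ε, ε]

/-- The payoffs of the column player, who is indifferent if the row player takes the first side with
probability `t`. -/
def colPayoff (ε t : ℝ) : Matrix (Fin 4) (Fin 2) ℝ :=
  !![-(ε * (1 - t)), 0; -(ε * (1 - t)), 0; 0, -(ε * t); 0, -(ε * t)]

theorem vec_mem_stdSimplex {a b c d : ℝ} (ha : 0 ≤ a) (hb : 0 ≤ b) (hc : 0 ≤ c) (hd : 0 ≤ d)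
    (h : a + b + c + d = 1) : ![a, b, c, d] ∈ stdSimplex ℝ (Fin 4) := by
  refine ⟨fun i => ?_, by simpa [Fin.sum_univ_four] using h⟩
  fin_cases i <;> simpa

/-- Row chooses side and bit independently, the side with weight `t` and the bit as the bonus
prefers; column mixes evenly. Then row is indifferent between sides and column between columns. -/
theorem exists_isNash {ε c t : ℝ} (ht : t ∈ Icc (0 : ℝ) 1) :
    ∃ x y, IsNash (rowPayoff ε c) (colPayoff ε t) x y := by
  obtain ⟨b, hb0, hb1, hcb⟩ : ∃ b : ℝ, 0 ≤ b ∧ b ≤ 1 ∧ ∀ s ∈ Icc (0 : ℝ) 1, c * s ≤ c * b := by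
    rcases le_total 0 c with hc | hc
    · exact ⟨1, by norm_num, le_rfl, fun s hs => mul_le_mul_of_nonneg_left hs.2 hc⟩
    · exact ⟨0, le_rfl, by norm_num, fun s hs => mul_le_mul_of_nonpos_left hs.1 hc⟩
  have ht' : 0 ≤ 1 - t := by linarith [ht.2]
  have hb' : 0 ≤ 1 - b := by linarith
  refine ⟨![t * b, t * (1 - b), (1 - t) * b, (1 - t) * (1 - b)], ![1 / 2, 1 / 2],
    vec_mem_stdSimplex (mul_nonneg ht.1 hb0) (mul_nonneg ht.1 hb') (mul_nonneg ht' hb0)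
      (mul_nonneg ht' hb') (by ring), ⟨fun i => ?_, by norm_num [Fin.sum_univ_two]⟩, ?_, ?_⟩
  · fin_cases i <;> norm_num
  · rintro w ⟨hw, hsum⟩
    rw [Fin.sum_univ_four] at hsum
    have := hcb (w 0 + w 2) ⟨add_nonneg (hw 0) (hw 2), by linarith [hw 1, hw 3]⟩
    simp [rowPayoff, dotProduct, Matrix.mulVec, Fin.sum_univ_four, Fin.sum_univ_two]
    linarith
  · rintro z ⟨hz, hsum⟩
    rw [Fin.sum_univ_two] at hsum
    obtain hz1 : z 1 = 1 - z 0 := by linarith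
    simp [colPayoff, dotProduct, Matrix.mulVec, Fin.sum_univ_four, Fin.sum_univ_two, hz1]
    apply le_of_eq
    ring

theorem IsNash.mem_simplex {n m : ℕ} {A B : Matrix (Fin n) (Fin m) ℝ} {x y}
    (h : IsNash A B x y) : (∀ i, 0 ≤ x i) ∧ ∑ i, x i = 1 ∧ (∀ j, 0 ≤ y j) ∧ ∑ j, y j = 1 :=
  ⟨h.1.1, h.1.2, h.2.1.1, h.2.1.2⟩

/-- Switching all weight to the favoured bit while keeping the side changes the payoff only through
the bonus. -/
theorem IsNash.bit {ε c t : ℝ} {x y} (h : IsNash (rowPayoff ε c) (colPayoff ε t) x y) :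
    (0 < c → x 0 + x 2 = 1) ∧ (c < 0 → x 0 + x 2 = 0) := by
  obtain ⟨hx, hxs, hy, hys⟩ := h.mem_simplex
  rw [Fin.sum_univ_four] at hxs
  rw [Fin.sum_univ_two] at hys
  have hy1 : y 1 = 1 - y 0 := by linarith
  constructor
  · intro hc
    have := h.2.2.1 ![x 0 + x 1, 0, x 2 + x 3, 0] (vec_mem_stdSimplex
      (add_nonneg (hx 0) (hx 1)) le_rfl (add_nonneg (hx 2) (hx 3)) le_rfl (by linarith))
    simp [rowPayoff, dotProduct, Matrix.mulVec, Fin.sum_univ_four, Fin.sum_univ_two, hy1] at this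
    have h' : c * (x 1 + x 3) ≤ 0 := by linarith
    have := nonpos_of_mul_nonpos_right h' hc
    linarith [hx 1, hx 3]
  · intro hc
    have := h.2.2.1 ![0, x 0 + x 1, 0, x 2 + x 3] (vec_mem_stdSimplex le_rfl
      (add_nonneg (hx 0) (hx 1)) le_rfl (add_nonneg (hx 2) (hx 3)) (by linarith))
    simp [rowPayoff, dotProduct, Matrix.mulVec, Fin.sum_univ_four, Fin.sum_univ_two, hy1] at this
    have h' : 0 ≤ c * (x 0 + x 2) := by linarith
    have := nonpos_of_mul_nonneg_right h' hc
    linarith [hx 0, hx 2]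

/-- Let `s` be the weight of the first side. If `s < t`, column plays the first column only, and
row's best reply is `s = 1 ≥ t`; if `s > t`, column plays the second, and the reply is `s = 0 ≤ t`.
Both are absurd. -/
theorem IsNash.side {ε c t : ℝ} (hε : 0 < ε) (ht : t ∈ Icc (0 : ℝ) 1) {x y}
    (h : IsNash (rowPayoff ε c) (colPayoff ε t) x y) : x 0 + x 1 = t := by
  obtain ⟨hx, hxs, hy, hys⟩ := h.mem_simplex
  rw [Fin.sum_univ_four] at hxs
  rw [Fin.sum_univ_two] at hys
  have hy1 : y 1 = 1 - y 0 := by linarith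
  have hx3 : x 3 = 1 - x 0 - x 1 - x 2 := by linarith
  -- These deviations move all weight to one side but keep the bit, so the bonus `c` cancels.
  have r₀ := h.2.2.1 ![x 0 + x 2, x 1 + x 3, 0, 0] (vec_mem_stdSimplex
    (add_nonneg (hx 0) (hx 2)) (add_nonneg (hx 1) (hx 3)) le_rfl le_rfl (by linarith))
  have r₁ := h.2.2.1 ![0, 0, x 0 + x 2, x 1 + x 3] (vec_mem_stdSimplex le_rfl le_rfl
    (add_nonneg (hx 0) (hx 2)) (add_nonneg (hx 1) (hx 3)) (by linarith))
  have c₀ := h.2.2.2 ![1, 0] ⟨fun i => by fin_cases i <;> simp, by simp⟩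
  have c₁ := h.2.2.2 ![0, 1] ⟨fun i => by fin_cases i <;> simp, by simp⟩
  simp [rowPayoff, dotProduct, Matrix.mulVec, Fin.sum_univ_four, Fin.sum_univ_two, hy1, hx3]
    at r₀ r₁
  simp [colPayoff, dotProduct, Matrix.mulVec, Fin.sum_univ_four, Fin.sum_univ_two, hy1, hx3]
    at c₀ c₁
  set s := x 0 + x 1 with hs
  have hs0 : 0 ≤ s := add_nonneg (hx 0) (hx 1)
  have hs1 : s ≤ 1 := by linarith [hx 2, hx 3]
  have hr₀ : ε * ((2 * y 0 - 1) * (1 - s)) ≤ 0 := by rw [hs]; linarith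
  have hr₁ : 0 ≤ ε * ((2 * y 0 - 1) * s) := by rw [hs]; linarith
  have hc₀ : 0 ≤ ε * ((1 - y 0) * (s - t)) := by rw [hs]; linarith
  have hc₁ : 0 ≤ ε * (y 0 * (t - s)) := by rw [hs]; linarith
  replace hr₀ := nonpos_of_mul_nonpos_right hr₀ hε
  replace hr₁ := nonneg_of_mul_nonneg_right hr₁ hε
  replace hc₀ := nonneg_of_mul_nonneg_right hc₀ hε
  replace hc₁ := nonneg_of_mul_nonneg_right hc₁ hε
  rcases lt_trichotomy s t with hst | hst | hst
  · have : y 0 = 1 := by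
      have := nonpos_of_mul_nonneg_left hc₀ (sub_neg.2 hst)
      linarith [hy 1]
    rw [this] at hr₀
    linarith [ht.2]
  · exact hst
  · have : y 0 = 0 := by
      have := nonpos_of_mul_nonneg_left hc₁ (sub_neg.2 hst)
      linarith [hy 0]
    rw [this] at hr₁
    linarith [ht.1]

/-- At stakes 0 without bonus the game is zero whatever `t` is. Small positive stakes force the side
weight to be `y`; a still smaller bonus of either sign then forces the bit and leaves the stakes
alone. -/
theorem isSplitting_NASH :
    IsSplitting NASH (fun v => coordValue id 0 v.2.2.1 + coordValue id 2 v.2.2.1)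
      (fun v => coordValue id 0 v.2.2.1 + coordValue id 1 v.2.2.1) := by
  have hcont : ∀ i j, NameContinuous fun v : Σ n : ℕ, Σ m : ℕ, (Fin n → ℝ) × (Fin m → ℝ) =>
      coordValue id i v.2.2.1 + coordValue id j v.2.2.1 := fun i j =>
    NameContinuous.sigma fun n => NameContinuous.sigma fun m =>
      (((nameContinuous_of_continuous continuous_id).coordValue i n).add
        ((nameContinuous_of_continuous continuous_id).coordValue j n)).comp_fst
  refine ⟨hcont 0 2, hcont 0 1, ?_⟩
  obtain ⟨Good, hname, hsurj, hnear⟩ := (hasOpenNames_matrix 4 2).prod (hasOpenNames_matrix 4 2)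
  let game (ε c t : ℝ) : Matrix (Fin 4) (Fin 2) ℝ × Matrix (Fin 4) (Fin 2) ℝ :=
    (rowPayoff ε c, colPayoff ε t)
  let inst (G : Matrix (Fin 4) (Fin 2) ℝ × Matrix (Fin 4) (Fin 2) ℝ) :
      Σ n : ℕ, Σ m : ℕ, Matrix (Fin n) (Fin m) ℝ × Matrix (Fin n) (Fin m) ℝ := ⟨4, 2, G⟩
  let code (p : Baire) : Baire := Baire.cons 4 (Baire.cons 2 p)
  have hcode : ∀ {p G}, Good p G → IsName (code p) (inst G) := fun {p G} h =>
    ⟨rfl, rfl, by simpa only [code, Baire.tail_cons] using hname p G h⟩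
  have hmem : ∀ {G v}, v ∈ NASH (inst G) → ∃ x y, IsNash G.1 G.2 x y ∧ v = ⟨4, 2, x, y⟩ := by
    rintro G v ⟨_, ⟨⟨x, y⟩, hxy, rfl⟩, rfl⟩
    exact ⟨x, y, hxy, rfl⟩
  have hne : ∀ {ε c t}, t ∈ Icc (0 : ℝ) 1 → (NASH (inst (game ε c t))).Nonempty := by
    intro ε c t ht
    obtain ⟨x, y, hxy⟩ := exists_isNash (ε := ε) (c := c) ht
    exact ⟨_, _, ⟨(x, y), hxy, rfl⟩, rfl⟩
  have hzero : ∀ t, game 0 0 t = game 0 0 0 := by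
    intro t; simp [game, colPayoff]
  have hcε : ∀ t, Continuous fun ε => game ε 0 t := by
    intro t
    refine Continuous.prodMk ?_ ?_ <;> refine continuous_matrix fun i j => ?_ <;>
      fin_cases i <;> fin_cases j <;> simp [rowPayoff, colPayoff] <;> fun_prop
  have hcc : ∀ ε t, Continuous fun c => game ε c t := by
    intro ε t
    refine Continuous.prodMk (continuous_matrix fun i j => ?_) continuous_const
    fin_cases i <;> fin_cases j <;> simp [rowPayoff] <;> fun_prop
  obtain ⟨p₀, hp₀⟩ := hsurj (game 0 0 0)
  refine ⟨code p₀, inst (game 0 0 0), hcode hp₀, hne (by simp), fun n y hy => ?_⟩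
  -- As `ε` tends to 0, the games with parameter `y` converge to the one zero game named by `p₀`,
  -- for every `y`.
  have hev := (hcε y).continuousAt.eventually ((hzero y).symm ▸ hnear p₀ _ n hp₀)
  obtain ⟨ε, ⟨p, hp, hpp⟩, hε⟩ := ((hev.filter_mono nhdsWithin_le_nhds).and
    (self_mem_nhdsWithin (a := (0 : ℝ)) (s := Ioi 0))).exists
  refine ⟨code p, inst (game ε 0 y), hcode hp, hne hy, (hpp.cons 2).cons 4, ?_, fun m b hb => ?_⟩
  · intro v hv
    obtain ⟨x, z, hxz, rfl⟩ := hmem hv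
    simpa [coordValue] using hxz.side hε hy
  have hev := (hcc ε y).continuousAt.eventually (hnear p _ m hp)
  rcases hb with rfl | rfl
  · obtain ⟨c, ⟨p', hp', hpp'⟩, hc⟩ := ((hev.filter_mono nhdsWithin_le_nhds).and
      (self_mem_nhdsWithin (a := (0 : ℝ)) (s := Iio 0))).exists
    refine ⟨code p', inst (game ε c y), hcode hp', hne hy, (hpp'.cons 2).cons 4, fun v hv => ?_⟩
    obtain ⟨x, z, hxz, rfl⟩ := hmem hv
    simpa [coordValue] using hxz.bit.2 hc
  · obtain ⟨c, ⟨p', hp', hpp'⟩, hc⟩ := ((hev.filter_mono nhdsWithin_le_nhds).and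
      (self_mem_nhdsWithin (a := (0 : ℝ)) (s := Ioi 0))).exists
    refine ⟨code p', inst (game ε c y), hcode hp', hne hy, (hpp'.cons 2).cons 4, fun v hv => ?_⟩
    obtain ⟨x, z, hxz, rfl⟩ := hmem hv
    simpa [coordValue] using hxz.bit.1 hc

end Weihrauch

theorem corollary17p6 :
    ¬ Weihrauch.Reducible
        ((Weihrauch.closedChoice Weihrauch.Two).prod (Weihrauch.allOrUniqueChoice unitInterval))
        (Weihrauch.connectedChoice unitInterval) ∧
    ¬ Weihrauch.Reducible
        (Weihrauch.allOrUniqueChoice unitInterval).star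
        (Weihrauch.connectedChoice unitInterval) ∧
    ¬ Weihrauch.Reducible Weihrauch.NASH Weihrauch.IVT :=
  ⟨Weihrauch.isSplitting_prod.not_reducible Weihrauch.isTame_connectedChoice,
    Weihrauch.isSplitting_star.not_reducible Weihrauch.isTame_connectedChoice,
    Weihrauch.isSplitting_NASH.not_reducible Weihrauch.isTame_IVT⟩
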